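/- For a finite simple graph $G=(V,E)$ and $x>0$ let $Z_G(x)=\sum_{D} x^{|V|-2|D|}$, the sum running over all families $D\subseteq E$ of pairwise vertex-disjoint edges (dimeric configurations), and let $\mathcal R_x(G,o)=\frac1{Z_G(x)}\sum_{D\,:\,o\text{ not covered by }D}x^{|V|-2|D|}$ be the probability that the vertex $o\in V$ is occupied by a monomer. Let $P=(P_k)_{k\ge0}$ and $\rho=(\rho_k)_{k\ge 0}$ be probability distributions on $\mathbb N$ with $\overline P=\sum_k kP_k<\infty$ and $\overline P\,\rho_k=(k+1)P_{k+1}$ for all $k$. Let $\mathcal T(P,\rho)$ be the unimodular Galton–Watson tree with root $o$: the numbers of sons of the nodes are independent, with distribution $P$ for the root and $\rho$ for every other node. Let $\mathcal T(P,\rho,r)$ be its subtree formed by the generations $0,\dots,r$. Let $G_n=(V_n,E_n)$, $n\in\mathbb N$, be random finite simple graphs defined on one probability space. For a vertex $v$ let $[G_n,v]_r$ be the subgraph of $G_n$ induced by the vertices at graph distance at most $r$ from $v$. Suppose that: (i) (local convergence to $\mathcal T(P,\rho)$) for every $r\in\mathbb N$ and every finite rooted tree $(T,o)$ with at most $r$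 generations, almost surely $$\frac1{|V_n|}\,\#\{v\in V_n : ([G_n,v]_r,v)\cong(T,o)\}\ \xrightarrow[n\to\infty]{}\ \mathbb P\big((\mathcal T(P,\rho,r),o)\cong(T,o)\big),$$ where $\cong$ is isomorphism of rooted graphs; (ii) (finite second moment) $\sum_k k^2P_k<\infty$; (iii) (uniform sparsity) almost surely $$\lim_{l\to\infty}\limsup_{n\to\infty}\frac1{|V_n|}\sum_{v\in V_n}\deg_{G_n}(v)\,\mathbf 1(\deg_{G_n}(v)\ge l)=0 .$$ Then, almost surely for every $x>0$, the limit $Y(x):=\lim_{r\to\infty}\mathcal R_x(\mathcal T(P,\rho,r),o)$ exists; $Y(x)$ is integrable, and $t\mapsto \mathbb E[Y(t)]/t$ is integrable between any two positive numbers. Moreover there is a deterministic function $p:(0,\infty)\to\mathbb R$ such that almost surely, for every $a>0$, $$\frac1{|V_n|}\log Z_{G_n}(a)\ \xrightarrow[n\to\infty]{}\ p(a),$$ and almost surely, for every $a>0$ and every $x>0$, $$\frac1{|V_n|}\log Z_{G_n}(x)\ \xrightarrow[n\to\infty]{}\ p(a)+\int_a^x\frac{\mathbb E[Y(t)]}{t}\,dt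 .$$ For every $a>0$ the function $x\mapsto p(a)+\int_a^x\frac{\mathbb E[Y(t)]}{t}\,dt$ is real analytic on $(0,\infty)$. -/

import Mathlib

open Filter Topology MeasureTheory Set
open scoped ENNReal

noncomputable section

namespace MonomerDimer

section Model

variable {V : Type*}

/-- `D` is a dimeric configuration on `G`: a family of edges of `G`, no two of which have a
vertex in common. -/
def IsDimeric (G : SimpleGraph V) (D : Finset (Sym2 V)) : Prop :=
  (∀ e ∈ D, e ∈ G.edgeSet) ∧ ∀ e ∈ D, ∀ f ∈ D, ∀ v : V, v ∈ e → v ∈ f → e = f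

variable [Fintype V]

open Classical in
/-- The set of all dimeric configurations on the finite graph `G`. -/
def dimericConfigs (G : SimpleGraph V) : Finset (Finset (Sym2 V)) :=
  Finset.univ.filter fun D => IsDimeric G D

/-- The weight `x ^ (|V| - 2 |D|)` of a dimeric configuration. The subtraction is not truncated,
since a dimeric configuration covers `2 |D|` distinct vertices. -/
def weight (x : ℝ) (D : Finset (Sym2 V)) : ℝ :=
  x ^ (Fintype.card V - 2 * D.card)

/-- The partition function `Z_G(x)`. -/
def partitionFunction (G : SimpleGraph V) (x : ℝ) : ℝ :=
  ∑ D ∈ dimericConfigs G, weight x D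

/-- The pressure per particle `(1 / |V|) log Z_G(x)`. -/
def pressurePerParticle (G : SimpleGraph V) (x : ℝ) : ℝ :=
  Real.log (partitionFunction G x) / Fintype.card V

open Classical in
/-- The set of vertices occupied by a monomer in the configuration `D`. -/
def monomers (D : Finset (Sym2 V)) : Finset V :=
  Finset.univ.filter fun v => ∀ u : V, s(u, v) ∉ D

/-- The expected value of `f` under the monomer-dimer measure
`μ_{G,x}(D) = weight x D / Z_G(x)`. -/
def expectation (G : SimpleGraph V) (x : ℝ) (f : Finset (Sym2 V) → ℝ) : ℝ :=
  ∑ D ∈ dimericConfigs G, f D * (weight x D / partitionFunction G x)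

open Classical in
/-- The probability `R_x(G, o)` of having a monomer on the vertex `o`. -/
def monomerProb (G : SimpleGraph V) (x : ℝ) (o : V) : ℝ :=
  expectation G x fun D => if o ∈ monomers D then 1 else 0

end Model

section Rooted

/-- Isomorphism of rooted graphs. -/
def RootedIso {V W : Type*} (G : SimpleGraph V) (v : V) (H : SimpleGraph W) (w : W) : Prop :=
  ∃ φ : G ≃g H, φ v = w

variable {V : Type*}

/-- The vertices at graph distance at most `r` from `v` (unreachable vertices are at distance
`⊤`). -/
def ballSet (G : SimpleGraph V) (v : V) (r : ℕ) : Set V := {u | G.edist v u ≤ r}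

/-- The ball `[G, v]_r`, as an induced subgraph of `G`. -/
def ball (G : SimpleGraph V) (v : V) (r : ℕ) : SimpleGraph (ballSet G v r) :=
  G.induce (ballSet G v r)

/-- The centre of the ball, as a vertex of the ball. -/
def ballCenter (G : SimpleGraph V) (v : V) (r : ℕ) : ballSet G v r :=
  ⟨v, by simp [ballSet]⟩

open Classical in
/-- The fraction of the vertices `v` of the finite graph `G` such that `([G, v]_r, v)` is
isomorphic to `(T, o)`. -/
def ballFraction {W : Type*} [Fintype V] (G : SimpleGraph V) (r : ℕ)
    (T : SimpleGraph W) (o : W) : ℝ :=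
  ((Finset.univ.filter fun v : V => RootedIso (ball G v r) (ballCenter G v r) T o).card : ℝ) /
    Fintype.card V

end Rooted

section GaltonWatson

/-! Galton-Watson trees. A node is coded by the list of the labels met on the way from the node
to the root; the root is `[]` and the sons of the node `u` are `0 :: u, 1 :: u, …`. An element
`k : List ℕ → ℕ` prescribes the number `k u` of sons of every (potential) node `u`. -/

/-- The nodes in the `r`-th generation. -/
def generation (k : List ℕ → ℕ) : ℕ → Finset (List ℕ)
  | 0 => {[]}
  | r + 1 => (generation k r).biUnion fun u => (Finset.range (k u)).image fun i => i :: u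

/-- The nodes in the generations `0, …, r`. -/
def treeNodes (k : List ℕ → ℕ) (r : ℕ) : Finset (List ℕ) :=
  (Finset.range (r + 1)).biUnion (generation k)

/-- The tree with offspring numbers `k`, truncated after generation `r`: two nodes are neighbours
if one is a son of the other. -/
def truncTree (k : List ℕ → ℕ) (r : ℕ) : SimpleGraph (treeNodes k r) where
  Adj u v := (∃ i : ℕ, v.1 = i :: u.1) ∨ ∃ i : ℕ, u.1 = i :: v.1
  symm := ⟨fun _ _ h => h.symm⟩
  loopless := ⟨fun u h => by
    rcases h with ⟨i, h⟩ | ⟨i, h⟩ <;> simpa using congrArg List.length h⟩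

/-- The root of the truncated tree. -/
def treeRoot (k : List ℕ → ℕ) (r : ℕ) : treeNodes k r :=
  ⟨[], Finset.mem_biUnion.2 ⟨0, by simp, by simp [generation]⟩⟩

/-- The law of the number of sons of a node: `P` for the root, `ρ` for all the other nodes. -/
def offspringLaw (P ρ : PMF ℕ) : List ℕ → Measure ℕ
  | [] => P.toMeasure
  | _ :: _ => ρ.toMeasure

instance (P ρ : PMF ℕ) (u : List ℕ) : IsProbabilityMeasure (offspringLaw P ρ u) := by
  cases u <;> unfold offspringLaw <;> infer_instance

/-- The law of the Galton-Watson tree `𝒯(P, ρ)`: the numbers of sons of the nodes are independent,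
with distribution `P` for the root and `ρ` for all the other nodes. -/
def gwMeasure (P ρ : PMF ℕ) : Measure (List ℕ → ℕ) :=
  Measure.infinitePi (offspringLaw P ρ)

/-- The limit `Y(x)`, as `r → ∞`, of the probability of having a monomer on the root of the tree
truncated after generation `r`. -/
def rootLimit (k : List ℕ → ℕ) (x : ℝ) : ℝ :=
  limUnder atTop fun r : ℕ => monomerProb (truncTree k r) x (treeRoot k r)

/-- `𝒯(P, ρ)` is unimodular: the mean of `P` is finite and
`ρ_k = (k + 1) P_{k+1} / mean` (written without the division; it is no condition on `ρ`
when `P` is the point mass at `0`, where no node but the root is ever used). -/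
def IsUnimodular (P ρ : PMF ℕ) : Prop :=
  (∑' j : ℕ, (j : ℝ≥0∞) * P j) < ∞ ∧
    ∀ k : ℕ, (∑' j : ℕ, (j : ℝ≥0∞) * P j) * ρ k = ((k : ℝ≥0∞) + 1) * P (k + 1)

end GaltonWatson

section Sequences

variable {Ω : Type*} [MeasurableSpace Ω] {V : ℕ → Ω → Type*} [∀ n ω, Fintype (V n ω)]

/-- Local convergence of the random graphs `G n` to `𝒯(P, ρ)`. Finite rooted trees are taken up
to isomorphism, so that their vertex set may be supposed to be some `Fin m`. -/
def LocallyConverges (μ : Measure Ω) (G : ∀ n ω, SimpleGraph (V n ω)) (P ρ : PMF ℕ) : Prop :=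
  ∀ (r m : ℕ) (T : SimpleGraph (Fin m)) (o : Fin m), T.IsTree → (∀ v, T.dist o v ≤ r) →
    ∀ᵐ ω ∂μ, Tendsto (fun n => ballFraction (G n ω) r T o) atTop
      (𝓝 ((gwMeasure P ρ).real {k | RootedIso (truncTree k r) (treeRoot k r) T o}))

open Classical in
/-- Uniform sparsity. The limits are taken in `[0, ∞]`. -/
def UniformlySparse (μ : Measure Ω) (G : ∀ n ω, SimpleGraph (V n ω)) : Prop :=
  ∀ᵐ ω ∂μ, Tendsto
    (fun l : ℕ => limsup (fun n : ℕ =>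
      (∑ v : V n ω, if l ≤ (G n ω).degree v then ((G n ω).degree v : ℝ≥0∞) else 0) /
        (Fintype.card (V n ω) : ℝ≥0∞)) atTop)
    atTop (𝓝 0)

end Sequences

end MonomerDimer

end

/-! The derivative of the pressure is the average monomer probability divided by `x`. So two facts
suffice: the averages converge to `E[Y(x)]`, and the constant of integration is fixed by the
behaviour at infinity.

The Heilmann-Lieb recursion `subPartition_eq` makes the monomer probability at a vertex an antitone
function of those at its neighbours once that vertex is deleted. Stopped after `d` steps with the
value 1, it bounds the true probability from above for even `d` and from below for odd `d`
(`subRatio_between`), and it sees only the ball of radius `d`. Local convergence thus turns the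
averaged bounds into expectations over truncated Galton-Watson trees, where the stopped recursion is
exact (`IsBranch.ratio_eq`). It remains to see that the even and odd bounds have the same limit.

One step of the recursion is Lipschitz with constant `1 / x ^ 2`, so consecutive truncations differ
at the root by at most the size of generation `r` times `x ^ (-2 r)`. The second moment makes
generations grow at most geometrically in mean, which gives almost sure convergence for large `x`.
Smaller `x` are reached by complex analysis: monomer probabilities extend holomorphically to `Re z >
0` with the bound `|z| / Re z` (`re_div_subPartition`), and Vitali's theorem propagates convergence.
The same theorem, applied to the averages over the finite graphs, makes the limit analytic.

Finally, sparsity bounds the number of edges by `C |V|`, so the pressure is within `C / x ^ 2` of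
`log x` for large `n`; letting `x` grow identifies the constant (`tendsto_pressure`). -/

open Filter Topology MeasureTheory Set
open scoped ENNReal

noncomputable section

namespace MonomerDimer

/-! ### Matchings of induced subgraphs, the Heilmann-Lieb recursion and its half-plane bounds. -/

section Subconfigurations

open Classical

variable {V : Type*}

/-- The neighbours of `o` in the finite set `S`, other than `o`. -/
def nbrs (G : SimpleGraph V) (S : Finset V) (o : V) : Finset V :=
  (S.erase o).filter (G.Adj o)

theorem mem_nbrs {G : SimpleGraph V} {S : Finset V} {o v : V} :
    v ∈ nbrs G S o ↔ v ∈ S ∧ G.Adj o v := by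
  simp only [nbrs, Finset.mem_filter, Finset.mem_erase]
  exact ⟨fun h => ⟨h.1.2, h.2⟩, fun h => ⟨⟨h.2.ne', h.1⟩, h.2⟩⟩

theorem IsDimeric.mono {G : SimpleGraph V} {D D' : Finset (Sym2 V)} (h : IsDimeric G D)
    (hD : D' ⊆ D) : IsDimeric G D' :=
  ⟨fun e he => h.1 e (hD he), fun e he f hf => h.2 e (hD he) f (hD hf)⟩

theorem card_erase_erase {G : SimpleGraph V} {S : Finset V} {o v : V} (ho : o ∈ S)
    (hv : v ∈ nbrs G S o) : ((S.erase o).erase v).card + 2 = S.card := by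
  have h1 : v ∈ S.erase o := (Finset.mem_filter.1 hv).1
  have := Finset.card_erase_add_one ho
  have := Finset.card_erase_add_one h1
  omega

variable [Fintype V]

/-- The dimeric configurations all of whose edges are contained in `S`. -/
def subConfigs (G : SimpleGraph V) (S : Finset V) : Finset (Finset (Sym2 V)) :=
  (dimericConfigs G).filter fun D => ∀ e ∈ D, ∀ v ∈ e, v ∈ S

/-- The partition function of the subgraph induced by `S`. -/
def subPartition {R : Type*} [CommSemiring R] (G : SimpleGraph V) (S : Finset V) (z : R) : R :=
  ∑ D ∈ subConfigs G S, z ^ (S.card - 2 * D.card)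

theorem mem_dimericConfigs {G : SimpleGraph V} {D : Finset (Sym2 V)} :
    D ∈ dimericConfigs G ↔ IsDimeric G D := by
  simp [dimericConfigs]

theorem mem_subConfigs {G : SimpleGraph V} {S : Finset V} {D : Finset (Sym2 V)} :
    D ∈ subConfigs G S ↔ IsDimeric G D ∧ ∀ e ∈ D, ∀ v ∈ e, v ∈ S := by
  simp [subConfigs, mem_dimericConfigs]

theorem subConfigs_univ (G : SimpleGraph V) : subConfigs G Finset.univ = dimericConfigs G := by
  ext D; simp [mem_subConfigs, mem_dimericConfigs]

theorem mem_subConfigs_erase {G : SimpleGraph V} {S : Finset V} {o : V} {D : Finset (Sym2 V)} :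
    D ∈ subConfigs G (S.erase o) ↔ D ∈ subConfigs G S ∧ ∀ e ∈ D, o ∉ e := by
  simp only [mem_subConfigs, Finset.mem_erase]
  constructor
  · rintro ⟨h, h'⟩
    exact ⟨⟨h, fun e he v hv => (h' e he v hv).2⟩, fun e he hv => (h' e he o hv).1 rfl⟩
  · rintro ⟨⟨h, h'⟩, ho⟩
    exact ⟨h, fun e he v hv => ⟨fun hvo => ho e he (hvo ▸ hv), h' e he v hv⟩⟩

/-- The vertices covered by a configuration. -/
def covered (D : Finset (Sym2 V)) : Finset V :=
  Finset.univ.filter fun v => ∃ e ∈ D, v ∈ e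

theorem card_covered {G : SimpleGraph V} {D : Finset (Sym2 V)} (h : IsDimeric G D) :
    (covered D).card = 2 * D.card := by
  have : covered D = D.biUnion Sym2.toFinset := by
    ext v; simp [covered]
  rw [this, Finset.card_biUnion, Finset.sum_const_nat (m := 2), mul_comm]
  · intro e he
    exact Sym2.card_toFinset_of_not_isDiag e (G.not_isDiag_of_mem_edgeSet (h.1 e he))
  · intro e he f hf hef
    rw [Function.onFun, Finset.disjoint_left]
    intro v hv hv'
    exact hef (h.2 e he f hf v (by simpa using hv) (by simpa using hv'))

theorem covered_subset {G : SimpleGraph V} {S : Finset V} {D : Finset (Sym2 V)}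
    (h : D ∈ subConfigs G S) : covered D ⊆ S := by
  intro v hv
  obtain ⟨e, he, hve⟩ := (Finset.mem_filter.1 hv).2
  exact (mem_subConfigs.1 h).2 e he v hve

theorem two_mul_card_le {G : SimpleGraph V} {S : Finset V} {D : Finset (Sym2 V)}
    (h : D ∈ subConfigs G S) : 2 * D.card ≤ S.card := by
  rw [← card_covered (mem_subConfigs.1 h).1]
  exact Finset.card_le_card (covered_subset h)

theorem insert_mem_subConfigs {G : SimpleGraph V} {S : Finset V} {o v : V}
    {D : Finset (Sym2 V)} (ho : o ∈ S) (hv : v ∈ nbrs G S o)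
    (hD : D ∈ subConfigs G ((S.erase o).erase v)) : insert s(o, v) D ∈ subConfigs G S := by
  rw [mem_nbrs] at hv
  rw [mem_subConfigs_erase, mem_subConfigs_erase] at hD
  obtain ⟨⟨hD, hDo⟩, hDv⟩ := hD
  rw [mem_subConfigs] at hD ⊢
  have hsep : ∀ e ∈ D, ∀ w ∈ s(o, v), w ∉ e := by
    intro e he w hw
    rcases Sym2.mem_iff.1 hw with rfl | rfl
    exacts [hDo e he, hDv e he]
  refine ⟨⟨fun e he => ?_, fun e he f hf w hwe hwf => ?_⟩, fun e he w hw => ?_⟩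
  · rcases Finset.mem_insert.1 he with rfl | he
    exacts [hv.2, hD.1.1 e he]
  · rcases Finset.mem_insert.1 he with rfl | he <;> rcases Finset.mem_insert.1 hf with rfl | hf
    · rfl
    · exact absurd hwf (hsep f hf w hwe)
    · exact absurd hwe (hsep e he w hwf)
    · exact hD.1.2 e he f hf w hwe hwf
  · rcases Finset.mem_insert.1 he with rfl | he
    · rcases Sym2.mem_iff.1 hw with rfl | rfl
      exacts [ho, hv.1]
    · exact hD.2 e he w hw

theorem edge_notMem {G : SimpleGraph V} {S : Finset V} {o v : V} {D : Finset (Sym2 V)}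
    (hD : D ∈ subConfigs G ((S.erase o).erase v)) : s(o, v) ∉ D := fun h =>
  (mem_subConfigs_erase.1 hD).2 _ h (Sym2.mem_mk_right o v)

/-- Either `o` is a monomer, or exactly one edge `s(o, v)` covers it and removing that edge leaves a
configuration avoiding both ends. -/
theorem subConfigs_eq (G : SimpleGraph V) {S : Finset V} {o : V} (ho : o ∈ S) :
    subConfigs G S = subConfigs G (S.erase o) ∪
      (nbrs G S o).biUnion fun v =>
        (subConfigs G ((S.erase o).erase v)).image (insert s(o, v)) := by
  ext D
  simp only [Finset.mem_union, Finset.mem_biUnion, Finset.mem_image]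
  constructor
  · intro hD
    by_cases h : ∀ e ∈ D, o ∉ e
    · exact Or.inl (mem_subConfigs_erase.2 ⟨hD, h⟩)
    · push Not at h
      obtain ⟨e, he, hoe⟩ := h
      obtain ⟨v, rfl⟩ := hoe
      have hD' := mem_subConfigs.1 hD
      refine Or.inr ⟨v, mem_nbrs.2 ⟨hD'.2 _ he v (Sym2.mem_mk_right o v), hD'.1.1 _ he⟩,
        D.erase s(o, v), ?_, Finset.insert_erase he⟩
      rw [mem_subConfigs_erase, mem_subConfigs_erase, mem_subConfigs]
      refine ⟨⟨⟨hD'.1.mono (Finset.erase_subset _ _), fun f hf =>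
        hD'.2 f (Finset.mem_of_mem_erase hf)⟩, fun f hf hof => ?_⟩, fun f hf hvf => ?_⟩
      · exact Finset.ne_of_mem_erase hf
          (hD'.1.2 f (Finset.mem_of_mem_erase hf) _ he o hof (Sym2.mem_mk_left o v))
      · exact Finset.ne_of_mem_erase hf
          (hD'.1.2 f (Finset.mem_of_mem_erase hf) _ he v hvf (Sym2.mem_mk_right o v))
  · rintro (hD | ⟨v, hv, D, hD, rfl⟩)
    · exact (mem_subConfigs_erase.1 hD).1
    · exact insert_mem_subConfigs ho hv hD

/-- The Heilmann-Lieb recursion. -/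
theorem subPartition_eq {R : Type*} [CommSemiring R] (G : SimpleGraph V) {S : Finset V} {o : V}
    (ho : o ∈ S) (z : R) :
    subPartition G S z = z * subPartition G (S.erase o) z +
      ∑ v ∈ nbrs G S o, subPartition G ((S.erase o).erase v) z := by
  have hcard := Finset.card_erase_add_one ho
  unfold subPartition
  rw [subConfigs_eq G ho, Finset.sum_union, Finset.sum_biUnion, Finset.mul_sum]
  · congr 1
    · refine Finset.sum_congr rfl fun D hD => ?_
      rw [← pow_succ']
      have := two_mul_card_le hD
      congr 1
      omega
    · refine Finset.sum_congr rfl fun v hv => ?_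
      rw [Finset.sum_image]
      · refine Finset.sum_congr rfl fun D hD => ?_
        rw [Finset.card_insert_of_notMem (edge_notMem hD)]
        have := card_erase_erase ho hv
        congr 1
        omega
      · intro D hD D' hD' h
        rw [← Finset.erase_insert (edge_notMem hD), ← Finset.erase_insert (edge_notMem hD')]
        exact congrArg (fun E => Finset.erase E s(o, v)) h
  · intro v _ w _ hvw
    rw [Function.onFun, Finset.disjoint_left]
    intro D hD hD'
    obtain ⟨E, hE, rfl⟩ := Finset.mem_image.1 hD
    obtain ⟨F, hF, hEF⟩ := Finset.mem_image.1 hD'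
    have h : s(o, w) ∈ insert s(o, v) E := by
      rw [← hEF]; exact Finset.mem_insert_self _ _
    rcases Finset.mem_insert.1 h with h | h
    · exact hvw (Sym2.congr_right.1 h).symm
    · exact (mem_subConfigs_erase.1 (mem_subConfigs_erase.1 hE).1).2 _ h (Sym2.mem_mk_left o w)
  · rw [Finset.disjoint_left]
    intro D hD hD'
    obtain ⟨v, hv, hD'⟩ := Finset.mem_biUnion.1 hD'
    obtain ⟨E, hE, rfl⟩ := Finset.mem_image.1 hD'
    exact (mem_subConfigs_erase.1 hD).2 _ (Finset.mem_insert_self _ _) (Sym2.mem_mk_left o v)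

theorem partitionFunction_eq (G : SimpleGraph V) (x : ℝ) :
    partitionFunction G x = subPartition G Finset.univ x := by
  simp [partitionFunction, subPartition, subConfigs_univ, weight]

theorem monomerProb_eq (G : SimpleGraph V) (x : ℝ) (o : V) :
    monomerProb G x o =
      x * subPartition G (Finset.univ.erase o) x / subPartition G Finset.univ x := by
  have key : ∀ D ∈ dimericConfigs G,
      (if o ∈ monomers D then (1 : ℝ) else 0) * (weight x D / partitionFunction G x) =
      if D ∈ subConfigs G (Finset.univ.erase o) then
        x * x ^ ((Finset.univ.erase o).card - 2 * D.card) / partitionFunction G x else 0 := by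
    intro D hD
    have hiff : o ∈ monomers D ↔ D ∈ subConfigs G (Finset.univ.erase o) := by
      rw [mem_subConfigs_erase, subConfigs_univ]
      simp only [monomers, Finset.mem_filter, Finset.mem_univ, true_and, hD]
      constructor
      · rintro h e he ⟨u, rfl⟩
        exact h u (Sym2.eq_swap ▸ he)
      · exact fun h u hu => h _ hu (Sym2.mem_mk_right u o)
    by_cases h : o ∈ monomers D
    · have hD' := hiff.1 h
      rw [if_pos h, if_pos hD', one_mul, weight, ← pow_succ']
      have := two_mul_card_le hD'
      have hc := Finset.card_erase_add_one (Finset.mem_univ o)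
      rw [Finset.card_univ] at hc
      congr 2
      omega
    · rw [if_neg h, if_neg (fun h' => h (hiff.2 h')), zero_mul]
  have hsub : subConfigs G (Finset.univ.erase o) ⊆ dimericConfigs G := fun D hD =>
    mem_dimericConfigs.2 (mem_subConfigs.1 hD).1
  rw [monomerProb, expectation, Finset.sum_congr rfl key, ← Finset.sum_filter,
    Finset.filter_mem_eq_inter, Finset.inter_eq_right.2 hsub, ← Finset.sum_div,
    ← Finset.mul_sum, partitionFunction_eq]
  rfl

theorem subPartition_pos (G : SimpleGraph V) (S : Finset V) {x : ℝ} (hx : 0 < x) :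
    0 < subPartition G S x := by
  refine Finset.sum_pos (fun D _ => pow_pos hx _) ⟨∅, ?_⟩
  simp [mem_subConfigs, IsDimeric]

theorem subPartition_ofReal (G : SimpleGraph V) (S : Finset V) (x : ℝ) :
    subPartition G S (x : ℂ) = (subPartition G S x : ℝ) := by
  simp [subPartition]

theorem differentiable_subPartition (G : SimpleGraph V) (S : Finset V) :
    Differentiable ℂ fun z : ℂ => subPartition G S z := by
  unfold subPartition; fun_prop

/-- Dividing the recursion by the partition function of `S.erase o` gives `z` plus ratios which, by
induction on the size of `S`, have positive real part. The sum therefore has real part at least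
`z.re`, and inversion preserves the right half-plane. -/
theorem re_div_subPartition (G : SimpleGraph V) {z : ℂ} (hz : 0 < z.re) (S : Finset V) :
    subPartition G S z ≠ 0 ∧ ∀ o ∈ S,
      0 < (subPartition G (S.erase o) z / subPartition G S z).re ∧
      ‖subPartition G (S.erase o) z / subPartition G S z‖ ≤ 1 / z.re := by
  induction hn : S.card using Nat.strong_induction_on generalizing S with
  | _ n ih =>
  subst hn
  have key : ∀ o ∈ S, ∃ w : ℂ, z.re ≤ w.re ∧
      subPartition G S z = subPartition G (S.erase o) z * w ∧
      subPartition G (S.erase o) z ≠ 0 := by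
    intro o ho
    obtain ⟨h0, h1⟩ := ih _ (Finset.card_erase_lt_of_mem ho) (S.erase o) rfl
    refine ⟨z + ∑ v ∈ nbrs G S o,
      subPartition G ((S.erase o).erase v) z / subPartition G (S.erase o) z, ?_, ?_, h0⟩
    · rw [Complex.add_re, Complex.re_sum]
      have := Finset.sum_nonneg fun v (hv : v ∈ nbrs G S o) =>
        (h1 v (Finset.mem_filter.1 hv).1).1.le
      linarith
    · rw [subPartition_eq G ho, mul_add, mul_comm, Finset.mul_sum]
      congr 1
      exact Finset.sum_congr rfl fun v _ => by field_simp
  constructor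
  · rcases S.eq_empty_or_nonempty with rfl | ⟨o, ho⟩
    · have h : subConfigs G (∅ : Finset V) = {∅} := by
        ext D
        simp only [mem_subConfigs, Finset.mem_singleton, Finset.notMem_empty, imp_false]
        constructor
        · rintro ⟨-, h⟩
          refine Finset.eq_empty_of_forall_notMem fun e he => ?_
          exact h e he _ (Sym2.out_fst_mem e)
        · rintro rfl
          simp [IsDimeric]
      simp [subPartition, h]
    · obtain ⟨w, hw, h, h0⟩ := key o ho
      rw [h]
      refine mul_ne_zero h0 fun hw0 => ?_
      rw [hw0, Complex.zero_re] at hw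
      linarith
  · intro o ho
    obtain ⟨w, hw, h, h0⟩ := key o ho
    have hw0 : w ≠ 0 := fun hw0 => by rw [hw0, Complex.zero_re] at hw; linarith
    rw [h, div_mul_cancel_left₀ h0]
    constructor
    · rw [Complex.inv_re]
      exact div_pos (hz.trans_le hw) (Complex.normSq_pos.2 hw0)
    · rw [norm_inv, one_div]
      exact inv_anti₀ hz (hw.trans ((le_abs_self _).trans (Complex.abs_re_le_norm w)))

/-- The monomer probability extends holomorphically to the right half-plane. -/
def complexMonomerProb (G : SimpleGraph V) (o : V) (z : ℂ) : ℂ :=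
  z * (subPartition G (Finset.univ.erase o) z / subPartition G Finset.univ z)

theorem complexMonomerProb_ofReal (G : SimpleGraph V) (o : V) (x : ℝ) :
    complexMonomerProb G o x = (monomerProb G x o : ℝ) := by
  simp [complexMonomerProb, monomerProb_eq, subPartition_ofReal, mul_div_assoc]

theorem norm_complexMonomerProb_le (G : SimpleGraph V) (o : V) {z : ℂ} (hz : 0 < z.re) :
    ‖complexMonomerProb G o z‖ ≤ ‖z‖ / z.re := by
  rw [complexMonomerProb, norm_mul, div_eq_mul_one_div ‖z‖]
  exact mul_le_mul_of_nonneg_left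
    ((re_div_subPartition G hz Finset.univ).2 o (Finset.mem_univ o)).2 (norm_nonneg z)

theorem differentiableOn_complexMonomerProb (G : SimpleGraph V) (o : V) :
    DifferentiableOn ℂ (complexMonomerProb G o) {z | 0 < z.re} := by
  intro z hz
  refine DifferentiableAt.differentiableWithinAt ?_
  exact differentiableAt_id.mul
    (((differentiable_subPartition G _) z).div ((differentiable_subPartition G _) z)
      (re_div_subPartition G hz _).1)

theorem monomerProb_nonneg (G : SimpleGraph V) {x : ℝ} (hx : 0 < x) (o : V) :
    0 ≤ monomerProb G x o := by
  rw [monomerProb_eq]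
  exact div_nonneg (mul_nonneg hx.le (subPartition_pos _ _ hx).le) (subPartition_pos _ _ hx).le

/-- The exponent of `x` in a weight is the number of monomers, so `x d/dx` inserts that number into
the sum. -/
theorem hasDerivAt_partitionFunction (G : SimpleGraph V) {x : ℝ} (hx : 0 < x) :
    HasDerivAt (partitionFunction G)
      (partitionFunction G x * (∑ v, monomerProb G x v) / x) x := by
  have h1 : HasDerivAt (partitionFunction G) (∑ D ∈ dimericConfigs G,
      ((Fintype.card V - 2 * D.card : ℕ) : ℝ) * x ^ (Fintype.card V - 2 * D.card - 1)) x := by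
    unfold partitionFunction weight
    exact HasDerivAt.fun_sum fun D _ => hasDerivAt_pow _ _
  convert h1 using 1
  have hZ : 0 < partitionFunction G x := by
    rw [partitionFunction_eq]; exact subPartition_pos _ _ hx
  simp only [monomerProb, expectation]
  rw [Finset.sum_comm, Finset.mul_sum, Finset.sum_div]
  refine Finset.sum_congr rfl fun D hD => ?_
  rw [← Finset.sum_mul, Finset.sum_boole]
  have hmon : (Finset.univ.filter fun v => v ∈ monomers D) = (covered D)ᶜ := by
    ext v
    simp only [monomers, covered, Finset.mem_filter, Finset.mem_univ, true_and,
      Finset.mem_compl]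
    constructor
    · rintro h ⟨e, he, u, rfl⟩
      exact h u (Sym2.eq_swap ▸ he)
    · exact fun h u hu => h ⟨_, hu, Sym2.mem_mk_right u v⟩
  have hcard : (Finset.univ.filter fun v => v ∈ monomers D).card =
      Fintype.card V - 2 * D.card := by
    rw [hmon, Finset.card_compl, card_covered (mem_dimericConfigs.1 hD)]
  rw [hcard, weight]
  generalize Fintype.card V - 2 * D.card = m
  rcases m with _ | m
  · simp
  · rw [Nat.add_sub_cancel, pow_succ]
    field_simp

theorem partitionFunction_ge (G : SimpleGraph V) {x : ℝ} (hx : 0 < x) :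
    x ^ Fintype.card V ≤ partitionFunction G x := by
  have h : (∅ : Finset (Sym2 V)) ∈ dimericConfigs G := by
    simp [mem_dimericConfigs, IsDimeric]
  simpa [weight, partitionFunction] using
    Finset.single_le_sum (f := weight x) (fun D _ => (pow_pos hx _).le) h

/-- Dropping the disjointness constraint leaves a sum over all sets of edges, which is a binomial
expansion. -/
theorem partitionFunction_le (G : SimpleGraph V) {x : ℝ} (hx : 0 < x) :
    partitionFunction G x ≤ x ^ Fintype.card V * (1 + (x ^ 2)⁻¹) ^ G.edgeFinset.card := by
  have hsub : dimericConfigs G ⊆ G.edgeFinset.powerset := by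
    intro D hD
    rw [Finset.mem_powerset]
    intro e he
    exact SimpleGraph.mem_edgeFinset.2 ((mem_dimericConfigs.1 hD).1 e he)
  have h1 : partitionFunction G x =
      ∑ D ∈ dimericConfigs G, x ^ Fintype.card V * (x ^ 2)⁻¹ ^ D.card := by
    refine Finset.sum_congr rfl fun D hD => ?_
    rw [← subConfigs_univ] at hD
    have := two_mul_card_le hD
    rw [weight, pow_sub₀ _ hx.ne' (by simpa using this), pow_mul, inv_pow]
  rw [h1, ← Finset.mul_sum]
  refine mul_le_mul_of_nonneg_left ?_ (pow_pos hx _).le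
  calc ∑ D ∈ dimericConfigs G, (x ^ 2)⁻¹ ^ D.card
      ≤ ∑ D ∈ G.edgeFinset.powerset, (x ^ 2)⁻¹ ^ D.card :=
        Finset.sum_le_sum_of_subset_of_nonneg hsub fun D _ _ => by positivity
    _ = (1 + (x ^ 2)⁻¹) ^ G.edgeFinset.card := by
        have := Finset.sum_pow_mul_eq_add_pow (x ^ 2)⁻¹ 1 G.edgeFinset
        simpa [add_comm] using this

end Subconfigurations

/-! ### The recursion stopped at finite depth, and its alternating bounds. -/

section Truncation

open Classical

variable {V W : Type*}

theorem mem_erase_iff {S : Finset V} {o v : V} : v ∈ S.erase o ↔ v ≠ o ∧ v ∈ S :=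
  Finset.mem_erase

/-- The monomer probability at `o` in the subgraph induced by `S`, computed by the Heilmann-Lieb
recursion stopped after `d` steps. -/
def truncRatio (G : SimpleGraph V) (x : ℝ) : ℕ → Finset V → V → ℝ
  | 0, _, _ => 1
  | d + 1, S, o => x ^ 2 / (x ^ 2 + ∑ v ∈ nbrs G S o, truncRatio G x d (S.erase o) v)

theorem truncRatio_mem (G : SimpleGraph V) {x : ℝ} (hx : 0 < x) (d : ℕ) (S : Finset V) (o : V) :
    truncRatio G x d S o ∈ Icc (0 : ℝ) 1 := by
  induction d generalizing S o with
  | zero => simp [truncRatio]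
  | succ d ih =>
    have h := Finset.sum_nonneg fun v (_ : v ∈ nbrs G S o) => (ih (S.erase o) v).1
    rw [truncRatio]
    exact ⟨by positivity, div_le_one_of_le₀ (by linarith) (by positivity)⟩

/-- The monomer probability at `o` in the subgraph induced by `S`. -/
def subRatio [Fintype V] (G : SimpleGraph V) (x : ℝ) (S : Finset V) (o : V) : ℝ :=
  x * subPartition G (S.erase o) x / subPartition G S x

theorem subRatio_pos [Fintype V] (G : SimpleGraph V) {x : ℝ} (hx : 0 < x) (S : Finset V) (o : V) :
    0 < subRatio G x S o :=
  div_pos (mul_pos hx (subPartition_pos _ _ hx)) (subPartition_pos _ _ hx)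

theorem subRatio_eq [Fintype V] (G : SimpleGraph V) {x : ℝ} (hx : 0 < x) {S : Finset V} {o : V}
    (ho : o ∈ S) :
    subRatio G x S o = x ^ 2 / (x ^ 2 + ∑ v ∈ nbrs G S o, subRatio G x (S.erase o) v) := by
  have h1 := subPartition_pos G (S.erase o) hx
  have hs : ∑ v ∈ nbrs G S o, subRatio G x (S.erase o) v =
      x * (∑ v ∈ nbrs G S o, subPartition G ((S.erase o).erase v) x) /
        subPartition G (S.erase o) x := by
    rw [Finset.mul_sum, Finset.sum_div]; rfl
  have h2 : 0 ≤ ∑ v ∈ nbrs G S o, subPartition G ((S.erase o).erase v) x :=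
    Finset.sum_nonneg fun v _ => (subPartition_pos _ _ hx).le
  rw [hs, subRatio, subPartition_eq G ho]
  field_simp

theorem subRatio_le_one [Fintype V] (G : SimpleGraph V) {x : ℝ} (hx : 0 < x) {S : Finset V}
    {o : V} (ho : o ∈ S) : subRatio G x S o ≤ 1 := by
  have h := Finset.sum_nonneg fun v (_ : v ∈ nbrs G S o) => (subRatio_pos G hx (S.erase o) v).le
  rw [subRatio_eq G hx ho]
  exact div_le_one_of_le₀ (by linarith) (by positivity)

/-- The initial value 1 is an upper bound, and each step is antitone in the values at the
neighbours, so the direction of the inequality alternates with `d`. -/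
theorem subRatio_between [Fintype V] (G : SimpleGraph V) {x : ℝ} (hx : 0 < x) (d : ℕ)
    {S : Finset V} {o : V} (ho : o ∈ S) :
    (Even d → subRatio G x S o ≤ truncRatio G x d S o) ∧
      (Odd d → truncRatio G x d S o ≤ subRatio G x S o) := by
  induction d generalizing S o with
  | zero => exact ⟨fun _ => subRatio_le_one G hx ho, fun h => by simp at h⟩
  | succ d ih =>
    have hmem : ∀ v ∈ nbrs G S o, v ∈ S.erase o := fun v hv => (Finset.mem_filter.1 hv).1
    have h0 := Finset.sum_nonneg fun v (_ : v ∈ nbrs G S o) =>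
      (truncRatio_mem G hx d (S.erase o) v).1
    have h1 := Finset.sum_nonneg fun v (_ : v ∈ nbrs G S o) => (subRatio_pos G hx (S.erase o) v).le
    rw [subRatio_eq G hx ho, truncRatio]
    constructor
    · intro h
      have h' : Odd d := by
        by_contra h''
        exact (Nat.not_even_iff_odd.2 (Nat.not_odd_iff_even.1 h'').add_one) h
      have := Finset.sum_le_sum fun v hv => (ih (hmem v hv)).2 h'
      gcongr
    · intro h
      have h' : Even d := by
        by_contra h''
        exact (Nat.not_even_iff_odd.2 h) (Nat.not_even_iff_odd.1 h'').add_one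
      have := Finset.sum_le_sum fun v hv => (ih (hmem v hv)).1 h'
      gcongr

theorem monomerProb_eq_subRatio [Fintype V] (G : SimpleGraph V) (x : ℝ) (o : V) :
    monomerProb G x o = subRatio G x Finset.univ o := monomerProb_eq G x o

theorem edist_le_succ_of_adj {G : SimpleGraph V} {u v w : V} {d : ℕ} (h : G.Adj u v)
    (hvw : G.edist v w ≤ d) : G.edist u w ≤ (d + 1 : ℕ) := by
  refine (SimpleGraph.edist_triangle (v := v)).trans ?_
  rw [SimpleGraph.edist_eq_one_iff_adj.2 h, Nat.cast_add, Nat.cast_one, add_comm]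
  gcongr

/-- The stopped recursion sees only the vertices within distance `d`. -/
theorem truncRatio_comap {G : SimpleGraph V} {H : SimpleGraph W} (φ : H ↪g G) (x : ℝ) (d : ℕ)
    {S : Finset V} {T : Finset W} {u : W} (hST : ∀ w, φ w ∈ S ↔ w ∈ T)
    (hball : ∀ v, G.edist (φ u) v ≤ d → v ∈ range φ) :
    truncRatio H x d T u = truncRatio G x d S (φ u) := by
  induction d generalizing S T u with
  | zero => rfl
  | succ d ih =>
    have hmap : nbrs G S (φ u) = (nbrs H T u).map φ.toEmbedding := by
      ext v
      simp only [mem_nbrs, Finset.mem_map]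
      constructor
      · rintro ⟨hv, hadj⟩
        obtain ⟨w, rfl⟩ := hball v <| by
          rw [SimpleGraph.edist_eq_one_iff_adj.2 hadj]
          exact_mod_cast Nat.le_add_left 1 d
        exact ⟨w, ⟨(hST w).1 hv, φ.map_adj_iff.1 hadj⟩, rfl⟩
      · rintro ⟨w, ⟨hw, hadj⟩, rfl⟩
        exact ⟨(hST w).2 hw, φ.map_adj_iff.2 hadj⟩
    rw [truncRatio, truncRatio, hmap, Finset.sum_map]
    congr 2
    refine Finset.sum_congr rfl fun v hv => ?_
    refine ih (fun w => ?_) fun w hw => hball w ?_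
    · rw [Finset.mem_erase, Finset.mem_erase, hST, φ.injective.ne_iff]
    · exact edist_le_succ_of_adj (φ.map_adj_iff.2 (mem_nbrs.1 hv).2) hw

theorem truncRatio_ball [Fintype V] (G : SimpleGraph V) (x : ℝ) (r : ℕ) (v : V) :
    truncRatio (ball G v r) x r Finset.univ (ballCenter G v r) =
      truncRatio G x r Finset.univ v :=
  truncRatio_comap (SimpleGraph.Embedding.induce (ballSet G v r)) x r (by simp)
    fun w hw => ⟨⟨w, hw⟩, rfl⟩

theorem RootedIso.truncRatio_eq [Fintype V] [Fintype W] {G : SimpleGraph V} {H : SimpleGraph W}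
    {v : V} {w : W} (h : RootedIso G v H w) (x : ℝ) (r : ℕ) :
    truncRatio G x r Finset.univ v = truncRatio H x r Finset.univ w := by
  obtain ⟨φ, rfl⟩ := h
  exact truncRatio_comap φ.toEmbedding x r (by simp) fun w _ => φ.surjective w

end Truncation

/-! ### The recursion on truncated trees. -/

section Tree

open Classical

/-- The root monomer probability of the subtree of descendants of `u` truncated after `r`
generations. -/
def treeRatio (k : List ℕ → ℕ) (x : ℝ) : ℕ → List ℕ → ℝ
  | 0, _ => 1
  | r + 1, u => x ^ 2 / (x ^ 2 + ∑ i ∈ Finset.range (k u), treeRatio k x r (i :: u))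

theorem length_of_mem_generation {k : List ℕ → ℕ} {r : ℕ} {u : List ℕ}
    (h : u ∈ generation k r) : u.length = r := by
  induction r generalizing u with
  | zero => simp [generation] at h; simp [h]
  | succ r ih =>
    simp only [generation, Finset.mem_biUnion, Finset.mem_image] at h
    obtain ⟨v, hv, i, -, rfl⟩ := h
    simp [ih hv]

theorem cons_mem_generation {k : List ℕ → ℕ} {r i : ℕ} {u : List ℕ} :
    i :: u ∈ generation k (r + 1) ↔ u ∈ generation k r ∧ i < k u := by
  simp only [generation, Finset.mem_biUnion, Finset.mem_image, Finset.mem_range]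
  constructor
  · rintro ⟨v, hv, j, hj, h⟩
    obtain ⟨rfl, rfl⟩ := List.cons_eq_cons.1 h
    exact ⟨hv, hj⟩
  · exact fun h => ⟨u, h.1, i, h.2, rfl⟩

theorem mem_treeNodes {k : List ℕ → ℕ} {r : ℕ} {u : List ℕ} :
    u ∈ treeNodes k r ↔ u.length ≤ r ∧ u ∈ generation k u.length := by
  simp only [treeNodes, Finset.mem_biUnion, Finset.mem_range]
  constructor
  · rintro ⟨s, hs, hu⟩
    have := length_of_mem_generation hu
    subst this
    exact ⟨by omega, hu⟩
  · exact fun h => ⟨_, by omega, h.2⟩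

theorem cons_mem_treeNodes {k : List ℕ → ℕ} {r i : ℕ} {u : List ℕ} :
    i :: u ∈ treeNodes k r ↔ u ∈ treeNodes k r ∧ u.length < r ∧ i < k u := by
  rw [mem_treeNodes, mem_treeNodes, List.length_cons, cons_mem_generation, Nat.succ_le_iff]
  exact ⟨fun h => ⟨⟨h.1.le, h.2.1⟩, h.1, h.2.2⟩, fun h => ⟨h.2.1, h.1.2, h.2.2⟩⟩

variable {k : List ℕ → ℕ} {r : ℕ}

/-- `S` contains the descendants of `u`, but not its parent. -/
def IsBranch (S : Finset (treeNodes k r)) (u : treeNodes k r) : Prop :=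
  (∀ w : treeNodes k r, u.1 <:+ w.1 → w ∈ S) ∧ ∀ w ∈ S, ∀ i, u.1 ≠ i :: w.1

theorem IsBranch.map_nbrs {S : Finset (treeNodes k r)} {u : treeNodes k r} (h : IsBranch S u) :
    (nbrs (truncTree k r) S u).map (Function.Embedding.subtype _) =
      if u.1.length < r then (Finset.range (k u.1)).image (fun i => i :: u.1) else ∅ := by
  ext w
  have : w ∈ (nbrs (truncTree k r) S u).map (Function.Embedding.subtype _) ↔
      ∃ i, w = i :: u.1 ∧ i < k u.1 ∧ u.1.length < r := by
    simp only [Finset.mem_map, mem_nbrs]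
    constructor
    · rintro ⟨v, ⟨hv, ⟨i, hi⟩ | ⟨i, hi⟩⟩, rfl⟩
      · have hv' := v.2
        rw [hi, cons_mem_treeNodes] at hv'
        exact ⟨i, hi, hv'.2.2, hv'.2.1⟩
      · exact absurd hi (h.2 v hv i)
    · rintro ⟨i, rfl, hi, hr⟩
      exact ⟨⟨i :: u.1, cons_mem_treeNodes.2 ⟨u.2, hr, hi⟩⟩,
        ⟨h.1 _ (List.suffix_cons i u.1), Or.inl ⟨i, rfl⟩⟩, rfl⟩
  rw [this]
  split_ifs with hr
  · simp only [Finset.mem_image, Finset.mem_range, hr, and_true]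
    exact ⟨fun ⟨i, h1, h2⟩ => ⟨i, h2, h1.symm⟩, fun ⟨i, h1, h2⟩ => ⟨i, h2.symm, h1⟩⟩
  · simp [hr]

theorem IsBranch.sum_nbrs {S : Finset (treeNodes k r)} {u : treeNodes k r} (h : IsBranch S u)
    (f : List ℕ → ℝ) : ∑ v ∈ nbrs (truncTree k r) S u, f v.1 =
      if u.1.length < r then ∑ i ∈ Finset.range (k u.1), f (i :: u.1) else 0 := by
  have h1 := Finset.sum_map (nbrs (truncTree k r) S u) (Function.Embedding.subtype _) f
  rw [h.map_nbrs] at h1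
  refine h1.symm.trans ?_
  split_ifs
  · exact Finset.sum_image fun i _ j _ hij => (List.cons_eq_cons.1 hij).1
  · rfl

theorem IsBranch.child {S S' : Finset (treeNodes k r)} {u v : treeNodes k r}
    (h : IsBranch S u) (hv : v ∈ nbrs (truncTree k r) S u)
    (hS' : ∀ w, w ∈ S' ↔ w ≠ u ∧ w ∈ S) : IsBranch S' v := by
  obtain ⟨hvS, ⟨i, hi⟩ | ⟨i, hi⟩⟩ := mem_nbrs.1 hv
  · refine ⟨fun w hw => (hS' w).2 ⟨?_, h.1 w ?_⟩, fun w hw j hj => ?_⟩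
    · rintro rfl
      have := hw.length_le
      rw [hi, List.length_cons] at this
      omega
    · exact (List.suffix_cons i u.1).trans (hi ▸ hw)
    · rw [hi] at hj
      exact ((hS' w).1 hw).1 (Subtype.ext (List.cons_eq_cons.1 hj).2.symm)
  · exact absurd hi (h.2 v hvS i)

/-- Deleting `u` from its branch makes each son the top of a branch of its own. `S` need not be the
branch alone: what else it contains is never met by the recursion. -/
theorem IsBranch.ratio_eq {x : ℝ} (hx : 0 < x) {d : ℕ} {S : Finset (treeNodes k r)}
    {u : treeNodes k r} (h : IsBranch S u) (hd : u.1.length + d = r) :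
    truncRatio (truncTree k r) x d S u = treeRatio k x d u.1 ∧
      subRatio (truncTree k r) x S u = treeRatio k x d u.1 := by
  induction d generalizing S u with
  | zero =>
    -- With no steps left, `u` lies in the last generation and is isolated in `S`, so its exact
    -- probability is the stopping value 1.
    refine ⟨rfl, ?_⟩
    have h0 : nbrs (truncTree k r) S u = ∅ := by
      have h1 := h.map_nbrs
      rwa [if_neg (by omega), Finset.map_eq_empty] at h1
    rw [subRatio_eq _ hx (h.1 u List.suffix_rfl), h0, treeRatio]
    simp [hx.ne']
  | succ d ih =>
    have h1 := h.sum_nbrs (treeRatio k x d)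
    rw [if_pos (by omega)] at h1
    have hlen : ∀ v ∈ nbrs (truncTree k r) S u, v.1.length + d = r := by
      intro v hv
      obtain ⟨hvS, ⟨i, hi⟩ | ⟨i, hi⟩⟩ := mem_nbrs.1 hv
      · rw [hi, List.length_cons]; omega
      · exact absurd hi (h.2 v hvS i)
    rw [truncRatio, subRatio_eq _ hx (h.1 u List.suffix_rfl), treeRatio, ← h1]
    constructor <;> congr 2 <;> refine Finset.sum_congr rfl fun v hv => ?_
    · refine (ih (h.child hv fun w => ?_) (hlen v hv)).1
      exact mem_erase_iff
    · refine (ih (h.child hv fun w => ?_) (hlen v hv)).2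
      exact mem_erase_iff

theorem isBranch_root (k : List ℕ → ℕ) (r : ℕ) : IsBranch Finset.univ (treeRoot k r) :=
  ⟨fun _ _ => Finset.mem_univ _, fun _ _ _ h => by simp [treeRoot] at h⟩

theorem truncRatio_truncTree (k : List ℕ → ℕ) (r : ℕ) {x : ℝ} (hx : 0 < x) :
    truncRatio (truncTree k r) x r Finset.univ (treeRoot k r) = treeRatio k x r [] :=
  ((isBranch_root k r).ratio_eq hx (by simp [treeRoot])).1

theorem monomerProb_truncTree (k : List ℕ → ℕ) (r : ℕ) {x : ℝ} (hx : 0 < x) :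
    monomerProb (truncTree k r) x (treeRoot k r) = treeRatio k x r [] :=
  (monomerProb_eq_subRatio _ _ _).trans
    ((isBranch_root k r).ratio_eq hx (by simp [treeRoot])).2

theorem treeRatio_mem (k : List ℕ → ℕ) {x : ℝ} (hx : 0 < x) (r : ℕ) (u : List ℕ) :
    treeRatio k x r u ∈ Icc (0 : ℝ) 1 := by
  induction r generalizing u with
  | zero => simp [treeRatio]
  | succ r ih =>
    have h := Finset.sum_nonneg fun i (_ : i ∈ Finset.range (k u)) => (ih (i :: u)).1
    rw [treeRatio]
    exact ⟨by positivity, div_le_one_of_le₀ (by linarith) (by positivity)⟩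

end Tree

/-! ### Vitali's theorem on a disc, through Taylor coefficients. -/

section Vitali

theorem norm_tsum_sub_first_le {a : ℕ → ℂ} {M R t : ℝ} (hR : 0 < R)
    (ha : ∀ j, ‖a j‖ ≤ M / R ^ j) (ht : 0 < t) (htR : t ≤ R / 2) :
    ‖(∑' j, a j * (t : ℂ) ^ j) - a 0‖ ≤ 2 * M / R * t := by
  have hq : t / R ≤ 1 / 2 := by rw [div_le_iff₀ hR]; linarith
  have hq0 : 0 ≤ t / R := by positivity
  have hM : 0 ≤ M := by simpa using (norm_nonneg _).trans (ha 0)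
  have hgeo := summable_geometric_of_lt_one hq0 (hq.trans_lt (by norm_num))
  have hb : ∀ j, ‖a j * (t : ℂ) ^ j‖ ≤ M * (t / R) ^ j := by
    intro j
    rw [norm_mul, norm_pow, Complex.norm_real, Real.norm_of_nonneg ht.le, div_pow, mul_div_assoc',
      mul_div_right_comm]
    exact mul_le_mul_of_nonneg_right (ha j) (by positivity)
  have hs : Summable fun j => a j * (t : ℂ) ^ j :=
    Summable.of_norm_bounded (hgeo.mul_left M) hb
  rw [hs.tsum_eq_zero_add, pow_zero, mul_one, add_sub_cancel_left]
  have h2 : HasSum (fun j : ℕ => M * (t / R) * (t / R) ^ j) (M * (t / R) * (1 - t / R)⁻¹) :=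
    (hasSum_geometric_of_lt_one hq0 (hq.trans_lt (by norm_num))).mul_left _
  refine (tsum_of_norm_bounded h2 fun j => (hb (j + 1)).trans_eq (by ring)).trans ?_
  have h3 : (1 - t / R)⁻¹ ≤ 2 := by
    rw [inv_le_comm₀ (by linarith) (by norm_num)]; linarith
  calc M * (t / R) * (1 - t / R)⁻¹ ≤ M * (t / R) * 2 := by gcongr
    _ = 2 * M / R * t := by ring

/-- Approximability by convergent sequences with arbitrarily small error gives the Cauchy property.
This serves both for Taylor coefficients and for the pressure. -/
theorem exists_tendsto_of_approx {E : Type*} [NormedAddCommGroup E] [CompleteSpace E]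
    {u : ℕ → E} {C δ : ℝ} (hδ : 0 < δ)
    (h : ∀ t : ℝ, 0 < t → t < δ → ∃ g : ℕ → E, (∃ l, Tendsto g atTop (𝓝 l)) ∧
      ∀ᶠ n in atTop, ‖g n - u n‖ ≤ C * t) : ∃ l, Tendsto u atTop (𝓝 l) := by
  apply cauchySeq_tendsto_of_complete
  rw [Metric.cauchySeq_iff']
  intro ε hε
  have hC : 0 < 4 * (|C| + 1) := by positivity
  -- Two approximation errors of at most `ε / 4` each leave `ε / 2` for the sequence `g`; `|C| + 1`
  -- avoids any assumption on the sign of `C`.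
  set t := min (δ / 2) (ε / (4 * (|C| + 1))) with ht
  have ht0 : 0 < t := by positivity
  have htδ : t < δ := (min_le_left _ _).trans_lt (by linarith)
  have htC : C * t ≤ ε / 4 := by
    have h1 : t ≤ ε / (4 * (|C| + 1)) := min_le_right _ _
    rw [le_div_iff₀ hC] at h1
    nlinarith [le_abs_self C]
  obtain ⟨g, ⟨l, hl⟩, hg⟩ := h t ht0 htδ
  obtain ⟨N, hN⟩ := Metric.cauchySeq_iff.1 hl.cauchySeq (ε / 2) (by positivity)
  obtain ⟨N', hN'⟩ := eventually_atTop.1 hg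
  refine ⟨max N N', fun n hn => ?_⟩
  have h1 := hN n ((le_max_left _ _).trans hn) _ (le_max_left N N')
  have h2 := hN' n ((le_max_right _ _).trans hn)
  have h3 := hN' _ (le_max_right N N')
  rw [dist_eq_norm] at h1 ⊢
  calc ‖u n - u (max N N')‖
      = ‖(g n - g (max N N')) - (g n - u n) + (g (max N N') - u (max N N'))‖ := by
        congr 1; abel
    _ ≤ ‖g n - g (max N N')‖ + ‖g n - u n‖ + ‖g (max N N') - u (max N N')‖ :=
        (norm_add_le _ _).trans (add_le_add_left (norm_sub_le _ _) _)
    _ < ε := by linarith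

/-- The value at a small `t` approximates the constant term uniformly in `n`, so the constant terms
converge. Subtracting them and dividing by `t` shifts the series, with `M / R` in place of `M`, and
the induction continues. -/
theorem exists_tendsto_coeff {a : ℕ → ℕ → ℂ} {M R δ : ℝ} (hR : 0 < R) (hδ : 0 < δ)
    (ha : ∀ n j, ‖a n j‖ ≤ M / R ^ j)
    (hconv : ∀ t : ℝ, 0 < t → t < δ → ∃ l, Tendsto (fun n => ∑' j, a n j * (t : ℂ) ^ j)
      atTop (𝓝 l)) (k : ℕ) : ∃ l, Tendsto (fun n => a n k) atTop (𝓝 l) := by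
  induction k generalizing a M δ with
  | zero =>
    refine exists_tendsto_of_approx (C := 2 * M / R) (lt_min hδ (half_pos hR))
      fun t ht htd => ⟨_, hconv t ht (htd.trans_le (min_le_left _ _)),
        Eventually.of_forall fun n => ?_⟩
    exact norm_tsum_sub_first_le hR (ha n) ht (htd.le.trans (min_le_right _ _))
  | succ k ih =>
    have h0 : ∃ l, Tendsto (fun n => a n 0) atTop (𝓝 l) := by
      refine exists_tendsto_of_approx (C := 2 * M / R) (lt_min hδ (half_pos hR))
        fun t ht htd => ⟨_, hconv t ht (htd.trans_le (min_le_left _ _)),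
        Eventually.of_forall fun n => ?_⟩
      exact norm_tsum_sub_first_le hR (ha n) ht (htd.le.trans (min_le_right _ _))
    obtain ⟨l0, hl0⟩ := h0
    refine ih (a := fun n j => a n (j + 1)) (M := M / R) (lt_min hδ hR)
      (fun n j => (ha n (j + 1)).trans_eq (by rw [pow_succ, div_div, mul_comm R])) fun t ht htd => ?_
    obtain ⟨l, hl⟩ := hconv t ht (htd.trans_le (min_le_left _ _))
    refine ⟨(l - l0) / t, ((hl.sub hl0).div_const (t : ℂ)).congr fun n => ?_⟩
    have htR : t / R < 1 := (div_lt_one hR).2 (htd.trans_le (min_le_right _ _))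
    have hs : Summable fun j => a n j * (t : ℂ) ^ j := by
      refine Summable.of_norm_bounded
        ((summable_geometric_of_lt_one (by positivity) htR).mul_left M) fun j => ?_
      rw [norm_mul, norm_pow, Complex.norm_real, Real.norm_of_nonneg ht.le, div_pow,
        mul_div_assoc', mul_div_right_comm]
      exact mul_le_mul_of_nonneg_right (ha n j) (by positivity)
    have ht0 : (t : ℂ) ≠ 0 := by exact_mod_cast ht.ne'
    rw [hs.tsum_eq_zero_add, pow_zero, mul_one, add_sub_cancel_left, div_eq_iff ht0, ← tsum_mul_right]
    exact tsum_congr fun j => by ring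

/-- Vitali's convergence theorem on a disc. -/
theorem exists_holomorphic_limit {f : ℕ → ℂ → ℂ} {c : ℝ} {R M δ : ℝ} (hR : 0 < R) (hδ : 0 < δ)
    (hf : ∀ n, DifferentiableOn ℂ (f n) (Metric.closedBall (c : ℂ) R))
    (hM : ∀ n, ∀ z ∈ Metric.closedBall (c : ℂ) R, ‖f n z‖ ≤ M)
    (hconv : ∀ t : ℝ, c < t → t < c + δ → ∃ l, Tendsto (fun n => f n t) atTop (𝓝 l)) :
    ∃ g : ℂ → ℂ, DifferentiableOn ℂ g (Metric.ball (c : ℂ) R) ∧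
      ∀ z ∈ Metric.ball (c : ℂ) R, Tendsto (fun n => f n z) atTop (𝓝 (g z)) := by
  have hdiff : ∀ n, DifferentiableOn ℂ (f n) (Metric.ball (c : ℂ) R) := fun n =>
    (hf n).mono Metric.ball_subset_closedBall
  set a : ℕ → ℕ → ℂ := fun n j => (j.factorial : ℂ)⁻¹ * iteratedDeriv j (f n) c with ha_def
  have ha : ∀ n j, ‖a n j‖ ≤ M / R ^ j := by
    intro n j
    have h := Complex.norm_iteratedDeriv_le_of_forall_mem_sphere_norm_le j hR
      ((hf n).diffContOnCl_ball subset_rfl)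
      (fun z hz => hM n z (Metric.sphere_subset_closedBall hz))
    rw [norm_mul, norm_inv, Complex.norm_natCast, inv_mul_le_iff₀ (by positivity)]
    exact h.trans_eq (mul_div_assoc _ _ _)
  have hsum : ∀ n, ∀ z ∈ Metric.ball (c : ℂ) R, ∑' j, a n j * (z - c) ^ j = f n z :=
    fun n z hz => Complex.taylorSeries_eq_on_ball' hz (hdiff n)
  have hcoef : ∀ k, ∃ l, Tendsto (fun n => a n k) atTop (𝓝 l) := by
    refine exists_tendsto_coeff hR (lt_min hδ hR) ha fun t ht htd => ?_
    obtain ⟨l, hl⟩ := hconv (c + t) (by linarith) (by linarith [htd.trans_le (min_le_left _ _)])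
    refine ⟨l, hl.congr fun n => ?_⟩
    rw [← hsum n]
    · simp
    · simpa [abs_of_pos ht] using htd.trans_le (min_le_right _ _)
  choose b hb using hcoef
  have hM0 : 0 ≤ M := (norm_nonneg _).trans (hM 0 c (Metric.mem_closedBall_self hR.le))
  have hlim : ∀ z ∈ Metric.ball (c : ℂ) R,
      Tendsto (fun n => f n z) atTop (𝓝 (∑' j, b j * (z - c) ^ j)) := by
    intro z hz
    have hzR : ‖z - c‖ / R < 1 := (div_lt_one hR).2 (by simpa [dist_eq_norm] using hz)
    refine Tendsto.congr (fun n => hsum n z hz) ?_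
    -- The Cauchy estimates `ha` supply a geometric majorant independent of `n`.
    refine tendsto_tsum_of_dominated_convergence
      ((summable_geometric_of_lt_one (by positivity) hzR).mul_left M)
      (fun j => (hb j).mul_const _) (Eventually.of_forall fun n j => ?_)
    rw [norm_mul, norm_pow, div_pow, mul_div_assoc', mul_div_right_comm]
    exact mul_le_mul_of_nonneg_right (ha n j) (by positivity)
  refine ⟨_, ?_, hlim⟩
  have hbb : ∀ j, ‖b j‖ ≤ M / R ^ j := fun j =>
    le_of_tendsto (hb j).norm (Eventually.of_forall fun n => ha n j)
  intro z hz
  obtain ⟨r, hzr, hrR⟩ := exists_between (Metric.mem_ball.1 hz)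
  have hr0 : 0 ≤ r := dist_nonneg.trans hzr.le
  refine (DifferentiableOn.differentiableAt (s := Metric.ball (c : ℂ) r) ?_
    (Metric.isOpen_ball.mem_nhds hzr)).differentiableWithinAt
  refine Complex.differentiableOn_tsum_of_summable_norm (u := fun j => M * (r / R) ^ j)
    ((summable_geometric_of_lt_one (by positivity) ((div_lt_one hR).2 hrR)).mul_left M)
    (fun j => by fun_prop) Metric.isOpen_ball fun j w hw => ?_
  rw [norm_mul, norm_pow, div_pow, mul_div_assoc', mul_div_right_comm]
  have hwr : ‖w - c‖ ≤ r := by simpa [dist_eq_norm] using (Metric.mem_ball.1 hw).le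
  exact mul_le_mul (hbb j) (pow_le_pow_left₀ (norm_nonneg _) hwr j) (by positivity) (by positivity)

end Vitali

/-! ### Propagation of convergence across the right half-plane. -/

section HalfPlane

/-- A sequence of holomorphic functions on the right half-plane, bounded by `‖z‖ / Re z`, which
converges on a real half-line, converges everywhere, to a holomorphic function. -/
theorem exists_holomorphic_limit_halfPlane {f : ℕ → ℂ → ℂ}
    (hf : ∀ n, DifferentiableOn ℂ (f n) {z | 0 < z.re})
    (hbound : ∀ n z, 0 < z.re → ‖f n z‖ ≤ ‖z‖ / z.re) {X : ℝ}
    (hconv : ∀ t : ℝ, X < t → ∃ l, Tendsto (fun n => f n t) atTop (𝓝 l)) {x : ℝ} (hx : 0 < x) :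
    ∃ g : ℂ → ℂ, DifferentiableOn ℂ g (Metric.ball (x : ℂ) (x / 2)) ∧
      ∀ z ∈ Metric.ball (x : ℂ) (x / 2), Tendsto (fun n => f n z) atTop (𝓝 (g z)) := by
  -- A single disc suffices: that of centre `c` and radius `c - x / 2` stays in `Re z ≥ x / 2`,
  -- contains the disc of radius `x / 2` about `x`, and has its centre at the edge of the region of
  -- known convergence or beyond.
  set c : ℝ := max X x with hc
  have hcx : x ≤ c := le_max_right _ _
  have hre : ∀ z ∈ Metric.closedBall (c : ℂ) (c - x / 2), x / 2 ≤ z.re := by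
    intro z hz
    rw [Metric.mem_closedBall, dist_eq_norm] at hz
    have h := (abs_le.1 ((Complex.abs_re_le_norm (z - c)).trans hz)).1
    rw [Complex.sub_re, Complex.ofReal_re] at h
    linarith
  obtain ⟨g, hg, hlim⟩ := exists_holomorphic_limit (f := f) (c := c) (R := c - x / 2)
    (M := 2 * c / (x / 2)) (δ := 1) (by linarith) one_pos
    (fun n => (hf n).mono fun z hz => (by linarith [hre z hz] : (0 : ℝ) < z.re))
    (fun n z hz => by
      have h := hre z hz
      have hn : ‖z‖ ≤ 2 * c := by
        rw [Metric.mem_closedBall, dist_eq_norm] at hz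
        have h1 := norm_add_le (z - c) c
        rw [sub_add_cancel, Complex.norm_real, Real.norm_of_nonneg (by linarith)] at h1
        linarith
      exact (hbound n z (by linarith)).trans (by gcongr))
    (fun t ht _ => hconv t ((le_max_left _ _).trans_lt ht))
  have hsub : Metric.ball (x : ℂ) (x / 2) ⊆ Metric.ball (c : ℂ) (c - x / 2) := by
    refine Metric.ball_subset_ball' ?_
    rw [dist_eq_norm, ← Complex.ofReal_sub, Complex.norm_real, Real.norm_of_nonpos (by linarith)]
    linarith
  exact ⟨g, hg.mono hsub, fun z hz => hlim z (hsub hz)⟩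

end HalfPlane

/-! ### Convergence at the root from the growth of generations; measurability. -/

section Generations

theorem sum_generation_succ {M : Type*} [AddCommMonoid M] (k : List ℕ → ℕ) (r : ℕ)
    (f : List ℕ → M) : ∑ v ∈ generation k (r + 1), f v =
      ∑ u ∈ generation k r, ∑ i ∈ Finset.range (k u), f (i :: u) := by
  rw [generation, Finset.sum_biUnion]
  · refine Finset.sum_congr rfl fun u _ => Finset.sum_image fun i _ j _ hij => ?_
    exact (List.cons_eq_cons.1 hij).1
  · intro u _ v _ huv
    rw [Function.onFun, Finset.disjoint_left]
    intro w hw hw'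
    obtain ⟨i, -, rfl⟩ := Finset.mem_image.1 hw
    obtain ⟨j, -, h⟩ := Finset.mem_image.1 hw'
    exact huv (List.cons_eq_cons.1 h).2.symm

/-- The map `A ↦ x ^ 2 / (x ^ 2 + A)` is Lipschitz on `A ≥ 0` with constant `1 / x ^ 2`. -/
theorem abs_treeRatio_succ_sub_le (k : List ℕ → ℕ) {x : ℝ} (hx : 0 < x) (r : ℕ) (u : List ℕ) :
    |treeRatio k x (r + 2) u - treeRatio k x (r + 1) u| ≤
      (x ^ 2)⁻¹ * ∑ i ∈ Finset.range (k u),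
        |treeRatio k x (r + 1) (i :: u) - treeRatio k x r (i :: u)| := by
  rw [treeRatio, treeRatio]
  set A := ∑ i ∈ Finset.range (k u), treeRatio k x (r + 1) (i :: u) with hA
  set B := ∑ i ∈ Finset.range (k u), treeRatio k x r (i :: u) with hB
  have hA0 : 0 ≤ A := Finset.sum_nonneg fun i _ => (treeRatio_mem k hx _ _).1
  have hB0 : 0 ≤ B := Finset.sum_nonneg fun i _ => (treeRatio_mem k hx _ _).1
  have h1 : |A - B| ≤ ∑ i ∈ Finset.range (k u),
      |treeRatio k x (r + 1) (i :: u) - treeRatio k x r (i :: u)| := by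
    rw [hA, hB, ← Finset.sum_sub_distrib]
    exact Finset.abs_sum_le_sum_abs _ _
  have hx2 : 0 < x ^ 2 := by positivity
  refine le_trans ?_ (mul_le_mul_of_nonneg_left h1 (by positivity))
  have h2 : x ^ 2 / (x ^ 2 + A) - x ^ 2 / (x ^ 2 + B) =
      -(x ^ 2 / ((x ^ 2 + A) * (x ^ 2 + B))) * (A - B) := by
    field_simp; ring
  rw [h2, abs_mul, abs_neg, abs_of_nonneg (by positivity)]
  refine mul_le_mul_of_nonneg_right ?_ (abs_nonneg _)
  rw [div_le_iff₀ (by positivity)]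
  have : x ^ 2 * x ^ 2 ≤ (x ^ 2 + A) * (x ^ 2 + B) := by gcongr <;> linarith
  rw [inv_mul_eq_div, le_div_iff₀ hx2]
  exact this

theorem abs_treeRatio_root_sub_le (k : List ℕ → ℕ) {x : ℝ} (hx : 0 < x) (r t : ℕ) :
    |treeRatio k x (t + r + 1) [] - treeRatio k x (t + r) []| ≤
      ((x ^ 2)⁻¹) ^ r * ∑ u ∈ generation k r, |treeRatio k x (t + 1) u - treeRatio k x t u| := by
  induction r generalizing t with
  | zero => simp [generation]
  | succ r ih =>
    have h := ih (t + 1)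
    rw [show t + 1 + r = t + (r + 1) by ring] at h
    refine h.trans ?_
    rw [sum_generation_succ, pow_succ (x ^ 2)⁻¹, mul_assoc]
    refine mul_le_mul_of_nonneg_left ?_ (by positivity)
    rw [Finset.mul_sum]
    exact Finset.sum_le_sum fun u _ => abs_treeRatio_succ_sub_le k hx t u

theorem tendsto_treeRatio_of_summable {k : List ℕ → ℕ} {c x : ℝ} (hc : 0 < c) (hx : 0 < x)
    (hcx : c ≤ x ^ 2) (hs : Summable fun r => ((generation k r).card : ℝ) * (c⁻¹) ^ r) :
    ∃ l, Tendsto (fun r => treeRatio k x r []) atTop (𝓝 l) := by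
  refine cauchySeq_tendsto_of_complete (cauchySeq_of_dist_le_of_summable _ (fun r => ?_) hs)
  have h := abs_treeRatio_root_sub_le k hx r 0
  rw [zero_add] at h
  rw [dist_comm, Real.dist_eq, mul_comm]
  refine h.trans (mul_le_mul (pow_le_pow_left₀ (by positivity) (inv_anti₀ hc hcx) r) ?_
    (Finset.sum_nonneg fun _ _ => abs_nonneg _) (by positivity))
  refine (Finset.sum_le_card_nsmul _ _ 1 fun u _ => ?_).trans_eq (by simp)
  have h1 := treeRatio_mem k hx 1 u
  have h0 := treeRatio_mem k hx 0 u
  rw [zero_add, abs_le]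
  constructor <;> linarith [h1.1, h1.2, h0.1, h0.2]

theorem tendsto_monomerProb_of_summable {k : List ℕ → ℕ} {c : ℝ} (hc : 0 < c)
    (hs : Summable fun r => ((generation k r).card : ℝ) * (c⁻¹) ^ r) {x : ℝ} (hx : 0 < x) :
    Tendsto (fun r => monomerProb (truncTree k r) x (treeRoot k r)) atTop
      (𝓝 (rootLimit k x)) := by
  suffices h : ∃ l, Tendsto (fun r => monomerProb (truncTree k r) x (treeRoot k r)) atTop (𝓝 l) by
    obtain ⟨l, hl⟩ := h
    rw [rootLimit, hl.limUnder_eq]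
    exact hl
  -- Beyond `max 1 c` one has `c ≤ t ^ 2`, where the summability estimate applies directly.
  obtain ⟨g, -, hg⟩ := exists_holomorphic_limit_halfPlane (X := max 1 c)
    (fun r => differentiableOn_complexMonomerProb (truncTree k r) (treeRoot k r))
    (fun r z hz => norm_complexMonomerProb_le (truncTree k r) (treeRoot k r) hz)
    (fun t ht => by
      have h1 : 1 < t := (le_max_left _ _).trans_lt ht
      have h2 : c < t := (le_max_right _ _).trans_lt ht
      obtain ⟨l, hl⟩ := tendsto_treeRatio_of_summable (x := t) hc (by linarith) (by nlinarith) hs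
      refine ⟨l, ((Complex.continuous_ofReal.tendsto l).comp hl).congr fun r => ?_⟩
      rw [complexMonomerProb_ofReal, monomerProb_truncTree k r (by linarith)]
      rfl) hx
  have h := hg x (Metric.mem_ball_self (by positivity))
  refine ⟨(g x).re, ((Complex.continuous_re.tendsto _).comp h).congr fun r => ?_⟩
  rw [Function.comp_apply, complexMonomerProb_ofReal, Complex.ofReal_re]

/-- Only the proper ancestors of `u` decide whether `u` is born; hence this event is independent of
the number of sons of `u`. -/
theorem mem_generation_congr {k k' : List ℕ → ℕ} {u : List ℕ} {r : ℕ}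
    (h : ∀ v, v <:+ u → v ≠ u → k v = k' v) : u ∈ generation k r ↔ u ∈ generation k' r := by
  induction u generalizing r with
  | nil =>
    rcases r with _ | r
    · simp [generation]
    · simp [generation]
  | cons i u ih =>
    have hne : u ≠ i :: u := (List.cons_ne_self i u).symm
    rcases r with _ | r
    · simp [generation]
    · rw [cons_mem_generation, cons_mem_generation, h u (List.suffix_cons i u) hne]
      rw [ih fun v hv hvu => h v (hv.trans (List.suffix_cons i u)) ?_]
      rintro rfl
      have := hv.length_le
      simp at this

theorem measurableSet_mem_generation (u : List ℕ) (r : ℕ) :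
    MeasurableSet {k : List ℕ → ℕ | u ∈ generation k r} := by
  induction u generalizing r with
  | nil =>
    rcases r with _ | r
    · simp [generation]
    · simp [generation]
  | cons i u ih =>
    rcases r with _ | r
    · simp [generation]
    · simp only [cons_mem_generation]
      exact (ih r).inter (measurableSet_lt measurable_const (measurable_pi_apply u))

theorem measurable_card_generation (r : ℕ) :
    Measurable fun k : List ℕ → ℕ => ((generation k r).card : ℝ≥0∞) := by
  classical
  have h : (fun k : List ℕ → ℕ => ((generation k r).card : ℝ≥0∞)) = fun k =>
      ∑' u, {k : List ℕ → ℕ | u ∈ generation k r}.indicator 1 k := by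
    funext k
    rw [tsum_eq_sum (s := generation k r) fun u hu => by simp [hu],
      Finset.sum_congr rfl fun u hu => indicator_of_mem (by exact hu) _]
    simp
  rw [h]
  exact Measurable.tsum fun u => measurable_one.indicator (measurableSet_mem_generation u r)

theorem measurable_treeRatio (x : ℝ) (r : ℕ) (u : List ℕ) :
    Measurable fun k : List ℕ → ℕ => treeRatio k x r u := by
  induction r generalizing u with
  | zero => exact measurable_const
  | succ r ih =>
    have h : Measurable fun p : ℕ × (List ℕ → ℕ) =>
        ∑ i ∈ Finset.range p.1, treeRatio p.2 x r (i :: u) :=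
      measurable_from_prod_countable_right fun n =>
        Finset.measurable_sum (Finset.range n) fun i _ => ih (i :: u)
    have hu : Measurable fun k : List ℕ → ℕ => k u := measurable_pi_apply u
    have h' : Measurable fun k : List ℕ → ℕ =>
        ∑ i ∈ Finset.range (k u), treeRatio k x r (i :: u) :=
      h.comp (hu.prodMk measurable_id)
    exact (h'.const_add _).const_div _

end Generations

/-! ### Mean generation sizes of the Galton-Watson tree. -/

section Expectation

open ProbabilityTheory Measure

variable (P ρ : PMF ℕ)

instance : IsProbabilityMeasure (gwMeasure P ρ) := by
  unfold gwMeasure; infer_instance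

theorem lintegral_offspring (u : List ℕ) :
    ∫⁻ k, (k u : ℝ≥0∞) ∂(gwMeasure P ρ) = ∫⁻ j, (j : ℝ≥0∞) ∂(offspringLaw P ρ u) :=
  (measurePreserving_eval_infinitePi (offspringLaw P ρ) u).lintegral_comp
    (measurable_of_countable _)

theorem lintegral_toMeasure (Q : PMF ℕ) :
    ∫⁻ j, (j : ℝ≥0∞) ∂Q.toMeasure = ∑' j : ℕ, (j : ℝ≥0∞) * Q j := by
  rw [lintegral_countable']
  refine tsum_congr fun j => ?_
  rw [PMF.toMeasure_apply_singleton _ _ (measurableSet_singleton j)]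

theorem lintegral_generation_mul (u : List ℕ) (r : ℕ) :
    ∫⁻ k, {k : List ℕ → ℕ | u ∈ generation k r}.indicator 1 k * (k u : ℝ≥0∞) ∂(gwMeasure P ρ) =
      gwMeasure P ρ {k | u ∈ generation k r} * ∫⁻ j, (j : ℝ≥0∞) ∂(offspringLaw P ρ u) := by
  classical
  set S : Finset (List ℕ) := u.tails.toFinset.erase u with hS
  have hmemS : ∀ v, v ∈ S ↔ v ≠ u ∧ v <:+ u := by simp [hS]
  have hind : iIndepFun (fun (v : List ℕ) (k : List ℕ → ℕ) => k v) (gwMeasure P ρ) :=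
    iIndepFun_infinitePi (X := fun _ j => j) fun _ => measurable_id
  have h1 := hind.indepFun_finset S {u} (by simp [hS]) measurable_pi_apply
  -- Here `S` is the set of proper ancestors, and the value 0 off `S` is immaterial. The domain is
  -- countable, so measurability is automatic.
  set φ : (S → ℕ) → ℝ≥0∞ := fun h =>
    if u ∈ generation (fun v => if hv : v ∈ S then h ⟨v, hv⟩ else 0) r then 1 else 0 with hφ
  have h2 := h1.comp (φ := φ) (ψ := fun h : ({u} : Finset (List ℕ)) → ℕ =>
    ((h ⟨u, Finset.mem_singleton_self u⟩ : ℕ) : ℝ≥0∞)) (measurable_of_countable _)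
    (measurable_of_countable _)
  have hφ' : (φ ∘ fun (k : List ℕ → ℕ) (i : S) => k i) =
      {k : List ℕ → ℕ | u ∈ generation k r}.indicator 1 := by
    funext k
    have : u ∈ generation (fun v => if v ∈ S then k v else 0) r ↔ u ∈ generation k r :=
      mem_generation_congr fun v hv hvu => by simp [(hmemS v).2 ⟨hvu, hv⟩]
    simp [hφ, this, indicator_apply]
  rw [hφ'] at h2
  have h3 := lintegral_mul_eq_lintegral_mul_lintegral_of_indepFun
    (measurable_one.indicator (measurableSet_mem_generation u r))
    ((measurable_of_countable fun j : ℕ => (j : ℝ≥0∞)).comp (measurable_pi_apply u)) h2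
  simp only [Pi.mul_apply] at h3
  refine h3.trans ?_
  rw [lintegral_indicator_one (measurableSet_mem_generation u r)]
  exact congrArg _ (lintegral_offspring P ρ u)

theorem lintegral_sum_generation (r : ℕ) (f : List ℕ → (List ℕ → ℕ) → ℝ≥0∞)
    (hf : ∀ u, Measurable (f u)) :
    ∫⁻ k, ∑ u ∈ generation k r, f u k ∂(gwMeasure P ρ) =
      ∑' u : List ℕ, ∫⁻ k, {k : List ℕ → ℕ | u ∈ generation k r}.indicator 1 k * f u k
        ∂(gwMeasure P ρ) := by
  classical
  have hmeas : ∀ u, Measurable fun k =>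
      {k : List ℕ → ℕ | u ∈ generation k r}.indicator (1 : (List ℕ → ℕ) → ℝ≥0∞) k * f u k := fun u =>
    (measurable_one.indicator (measurableSet_mem_generation u r)).mul (hf u)
  rw [← lintegral_tsum fun u => (hmeas u).aemeasurable]
  refine lintegral_congr fun k => ?_
  rw [tsum_eq_sum (s := generation k r) fun u hu => by simp [hu]]
  exact Finset.sum_congr rfl fun u hu => by simp [hu]

theorem lintegral_card_generation (r : ℕ) :
    ∫⁻ k, ((generation k r).card : ℝ≥0∞) ∂(gwMeasure P ρ) =
      ∑' u : List ℕ, gwMeasure P ρ {k | u ∈ generation k r} := by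
  have h := lintegral_sum_generation P ρ r (fun _ _ => 1) fun _ => measurable_const
  simp only [Finset.sum_const, nsmul_eq_mul, mul_one] at h
  rw [h]
  exact tsum_congr fun u => lintegral_indicator_one (measurableSet_mem_generation u r)

theorem lintegral_card_generation_succ (r : ℕ) :
    ∫⁻ k, ((generation k (r + 1)).card : ℝ≥0∞) ∂(gwMeasure P ρ) =
      ∑' u : List ℕ, gwMeasure P ρ {k | u ∈ generation k r} *
        ∫⁻ j, (j : ℝ≥0∞) ∂(offspringLaw P ρ u) := by
  have h := lintegral_sum_generation P ρ r (fun u k => (k u : ℝ≥0∞)) fun u =>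
    (measurable_of_countable fun j : ℕ => (j : ℝ≥0∞)).comp (measurable_pi_apply u)
  simp only [lintegral_generation_mul] at h
  rw [← h]
  refine lintegral_congr fun k => ?_
  rw [Finset.card_eq_sum_ones, sum_generation_succ]
  simp

theorem lintegral_card_generation_eq (r : ℕ) :
    ∫⁻ k, ((generation k (r + 1)).card : ℝ≥0∞) ∂(gwMeasure P ρ) =
      (∑' j : ℕ, (j : ℝ≥0∞) * P j) * (∑' j : ℕ, (j : ℝ≥0∞) * ρ j) ^ r := by
  induction r with
  | zero =>
    rw [lintegral_card_generation_succ, tsum_eq_single [] fun u hu => by simp [generation, hu]]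
    simp [generation, offspringLaw, lintegral_toMeasure]
  | succ r ih =>
    rw [lintegral_card_generation_succ, pow_succ, ← mul_assoc, ← ih, lintegral_card_generation,
      ← ENNReal.tsum_mul_right]
    refine tsum_congr fun u => ?_
    rcases u with _ | ⟨i, u⟩
    · have : {k : List ℕ → ℕ | [] ∈ generation k (r + 1)} = ∅ := by
        ext k; simp [generation]
      simp [this]
    · rw [offspringLaw, lintegral_toMeasure]

variable {P ρ}

/-- By unimodularity the product is `∑ j (j + 1) P (j + 1)`, at most the second moment. The product
form also covers a vanishing mean of `P`, when `ρ` is arbitrary. -/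
theorem mul_mean_lt_top (hunimodular : IsUnimodular P ρ)
    (hmoment : ∑' k : ℕ, (k : ℝ≥0∞) ^ 2 * P k < ∞) :
    (∑' j : ℕ, (j : ℝ≥0∞) * P j) * (∑' j : ℕ, (j : ℝ≥0∞) * ρ j) < ∞ := by
  refine lt_of_le_of_lt ?_ hmoment
  rw [← ENNReal.tsum_mul_left, tsum_eq_zero_add' (f := fun k : ℕ => (k : ℝ≥0∞) ^ 2 * P k)
    ENNReal.summable]
  refine le_add_left (ENNReal.tsum_le_tsum fun j => ?_)
  rw [mul_left_comm, hunimodular.2 j, ← mul_assoc, Nat.cast_add, Nat.cast_one, sq]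
  gcongr
  exact le_self_add

theorem ae_summable_card_generation (hunimodular : IsUnimodular P ρ)
    (hmoment : ∑' k : ℕ, (k : ℝ≥0∞) ^ 2 * P k < ∞) :
    ∃ c : ℝ, 0 < c ∧ ∀ᵐ k ∂(gwMeasure P ρ),
      Summable fun r => ((generation k r).card : ℝ) * (c⁻¹) ^ r := by
  obtain ⟨m, hm⟩ : ∃ m : ℝ, 0 ≤ m ∧ ∀ r, ∫⁻ k, ((generation k (r + 1)).card : ℝ≥0∞)
      ∂(gwMeasure P ρ) ≤ (∑' j : ℕ, (j : ℝ≥0∞) * P j) * ENNReal.ofReal m ^ r := by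
    by_cases h0 : (∑' j : ℕ, (j : ℝ≥0∞) * P j) = 0
    · exact ⟨0, le_rfl, fun r => by rw [lintegral_card_generation_eq, h0]; simp⟩
    · have hfin : (∑' j : ℕ, (j : ℝ≥0∞) * ρ j) ≠ ∞ := fun htop => by
        have := mul_mean_lt_top hunimodular hmoment
        rw [htop, ENNReal.mul_top h0] at this
        exact lt_irrefl _ this
      refine ⟨(∑' j : ℕ, (j : ℝ≥0∞) * ρ j).toReal, ENNReal.toReal_nonneg, fun r => ?_⟩
      rw [ENNReal.ofReal_toReal hfin, lintegral_card_generation_eq]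
  obtain ⟨hm0, hm⟩ := hm
  -- Generations have mean of order `m ^ r`; the choice `c = m + 1` makes the ratio `m / c` strictly
  -- less than 1, so the expected series is finite.
  have hc : 0 < m + 1 := by linarith
  refine ⟨m + 1, hc, ?_⟩
  set q : ℝ≥0∞ := ENNReal.ofReal (m + 1)⁻¹ with hq
  have hmeas : ∀ r, Measurable fun k : List ℕ → ℕ => ((generation k (r + 1)).card : ℝ≥0∞) :=
    fun r => measurable_card_generation (r + 1)
  have hint : ∫⁻ k, ∑' r, ((generation k (r + 1)).card : ℝ≥0∞) * q ^ r ∂(gwMeasure P ρ) ≠ ∞ := by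
    rw [lintegral_tsum fun r => ((hmeas r).mul_const _).aemeasurable]
    have hmq : ENNReal.ofReal m * q < 1 := by
      rw [hq, ← ENNReal.ofReal_mul hm0, ENNReal.ofReal_lt_one, ← div_eq_mul_inv, div_lt_one hc]
      linarith
    refine ne_top_of_le_ne_top (ENNReal.mul_ne_top hunimodular.1.ne
      (ENNReal.inv_ne_top.2 (tsub_pos_of_lt hmq).ne')) ((ENNReal.tsum_le_tsum fun r => ?_).trans_eq
        (by rw [ENNReal.tsum_mul_left, ENNReal.tsum_geometric]))
    rw [lintegral_mul_const _ (hmeas r), mul_pow, ← mul_assoc]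
    gcongr
    exact hm r
  filter_upwards [ae_lt_top (Measurable.tsum fun r => (hmeas r).mul_const _) hint] with k hk
  rw [← summable_nat_add_iff 1]
  have h := (ENNReal.summable_toReal hk.ne).mul_right (m + 1)⁻¹
  refine h.congr fun r => ?_
  rw [ENNReal.toReal_mul, ENNReal.toReal_pow, hq, ENNReal.toReal_ofReal (by positivity), pow_succ,
    ENNReal.toReal_natCast, mul_assoc]

theorem ae_tendsto_rootLimit (hunimodular : IsUnimodular P ρ)
    (hmoment : ∑' k : ℕ, (k : ℝ≥0∞) ^ 2 * P k < ∞) :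
    ∀ᵐ k ∂(gwMeasure P ρ), ∀ x : ℝ, 0 < x →
      Tendsto (fun r : ℕ => monomerProb (truncTree k r) x (treeRoot k r)) atTop
        (𝓝 (rootLimit k x)) := by
  obtain ⟨c, hc, h⟩ := ae_summable_card_generation hunimodular hmoment
  filter_upwards [h] with k hk x hx
  exact tendsto_monomerProb_of_summable hc hk hx

end Expectation

/-! ### Truncated trees are trees. -/

section TreeShape

theorem exists_walk_truncTree (k : List ℕ → ℕ) (r : ℕ) (u : List ℕ) (hu : u ∈ treeNodes k r) :
    ∃ p : (truncTree k r).Walk (treeRoot k r) ⟨u, hu⟩, p.length = u.length := by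
  induction u with
  | nil => exact ⟨SimpleGraph.Walk.nil, rfl⟩
  | cons i u ih =>
    have hu' := (cons_mem_treeNodes.1 hu).1
    obtain ⟨p, hp⟩ := ih hu'
    have hadj : (truncTree k r).Adj ⟨u, hu'⟩ ⟨i :: u, hu⟩ := Or.inl ⟨i, rfl⟩
    exact ⟨p.concat hadj, by rw [SimpleGraph.Walk.length_concat, hp, List.length_cons]⟩

theorem connected_truncTree (k : List ℕ → ℕ) (r : ℕ) : (truncTree k r).Connected :=
  SimpleGraph.connected_iff_exists_forall_reachable _ |>.2 ⟨treeRoot k r, fun u =>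
    (exists_walk_truncTree k r u.1 u.2).choose.reachable⟩

theorem isTree_truncTree (k : List ℕ → ℕ) (r : ℕ) : (truncTree k r).IsTree := by
  classical
  rw [SimpleGraph.isTree_iff_connected_and_card]
  refine ⟨connected_truncTree k r,
    le_antisymm ?_ (connected_truncTree k r).card_vert_le_card_edgeSet_add_one⟩
  -- Each edge is the image of its lower end, which is not the root, so there are fewer edges than
  -- nodes. The `else` branch is a dummy value.
  set g : treeNodes k r → Sym2 (treeNodes k r) := fun u =>
    s(u, if h : u.1.tail ∈ treeNodes k r then ⟨u.1.tail, h⟩ else u) with hg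
  have hcover : (truncTree k r).edgeSet ⊆ g '' {treeRoot k r}ᶜ := by
    have key : ∀ u v : treeNodes k r, (∃ i, v.1 = i :: u.1) →
        s(u, v) ∈ g '' {treeRoot k r}ᶜ := by
      rintro u v ⟨i, hi⟩
      refine ⟨v, fun h => ?_, ?_⟩
      · rw [mem_singleton_iff.1 h] at hi
        simp [treeRoot] at hi
      · have h : v.1.tail = u.1 := by rw [hi, List.tail_cons]
        have hmem : v.1.tail ∈ treeNodes k r := h ▸ u.2
        rw [hg]
        simp only [hmem, dite_true]
        rw [Sym2.eq_swap]
        congr 2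
    intro e he
    induction e with
    | _ u v =>
      rcases he with h | h
      · exact key u v h
      · rw [Sym2.eq_swap]; exact key v u h
  have h1 := (ncard_le_ncard hcover (toFinite _)).trans (ncard_image_le (toFinite _))
  rw [ncard_compl, ncard_singleton] at h1
  have h2 : 0 < Nat.card (treeNodes k r) := Nat.card_pos_iff.2 ⟨⟨treeRoot k r⟩, inferInstance⟩
  have h3 : Nat.card (truncTree k r).edgeSet = (truncTree k r).edgeSet.ncard := rfl
  omega

end TreeShape

/-! ### Countably many isomorphism classes of finite rooted graphs. -/

section Classes

theorem RootedIso.symm {V W : Type*} {G : SimpleGraph V} {v : V} {H : SimpleGraph W} {w : W}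
    (h : RootedIso G v H w) : RootedIso H w G v := by
  obtain ⟨φ, rfl⟩ := h
  exact ⟨φ.symm, φ.symm_apply_apply v⟩

theorem RootedIso.trans {U V W : Type*} {F : SimpleGraph U} {u : U} {G : SimpleGraph V} {v : V}
    {H : SimpleGraph W} {w : W} (h : RootedIso F u G v) (h' : RootedIso G v H w) :
    RootedIso F u H w := by
  obtain ⟨φ, rfl⟩ := h
  obtain ⟨ψ, rfl⟩ := h'
  exact ⟨φ.trans ψ, rfl⟩

/-- Rooted graphs whose vertex set is some `Fin m`. -/
def FinRooted : Type := Σ m : ℕ, SimpleGraph (Fin m) × Fin m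

instance : Countable FinRooted := by unfold FinRooted; infer_instance

/-- Isomorphism of rooted graphs as an equivalence relation. -/
def rootedSetoid : Setoid FinRooted where
  r p q := RootedIso p.2.1 p.2.2 q.2.1 q.2.2
  iseqv := ⟨fun _ => ⟨SimpleGraph.Iso.refl, rfl⟩, RootedIso.symm, RootedIso.trans⟩

/-- Isomorphism classes of finite rooted graphs. -/
def RootedClass : Type := Quotient rootedSetoid

instance : Countable RootedClass := by unfold RootedClass; infer_instance

instance : MeasurableSpace RootedClass := ⊤

instance : DiscreteMeasurableSpace RootedClass := ⟨fun _ => trivial⟩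

/-- A representative of an isomorphism class. -/
def RootedClass.rep (q : RootedClass) : FinRooted := Quotient.out q

variable {V W : Type*}

theorem exists_rootedIso [Finite V] (G : SimpleGraph V) (v : V) :
    ∃ p : FinRooted, RootedIso G v p.2.1 p.2.2 := by
  obtain ⟨m, ⟨e⟩⟩ := Finite.exists_equiv_fin V
  exact ⟨⟨m, G.map e.toEmbedding, e v⟩, SimpleGraph.Iso.map e G, rfl⟩

/-- The isomorphism class of a finite rooted graph. -/
def rootedClass [Finite V] (G : SimpleGraph V) (v : V) : RootedClass :=
  Quotient.mk _ (exists_rootedIso G v).choose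

theorem rootedClass_eq_iff_rep [Finite V] {G : SimpleGraph V} {v : V} {q : RootedClass} :
    rootedClass G v = q ↔ RootedIso G v q.rep.2.1 q.rep.2.2 := by
  have h := (exists_rootedIso G v).choose_spec
  exact ⟨fun h' => h.trans (Quotient.exact (h'.trans (Quotient.out_eq q).symm)),
    fun h' => (Quotient.sound (h.symm.trans h')).trans (Quotient.out_eq q)⟩

theorem rootedIso_rep [Finite V] (G : SimpleGraph V) (v : V) :
    RootedIso G v (rootedClass G v).rep.2.1 (rootedClass G v).rep.2.2 :=
  rootedClass_eq_iff_rep.1 rfl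

theorem RootedIso.rootedClass_eq [Finite V] [Finite W] {G : SimpleGraph V} {v : V}
    {H : SimpleGraph W} {w : W} (h : RootedIso G v H w) : rootedClass G v = rootedClass H w :=
  rootedClass_eq_iff_rep.2 (h.trans (rootedIso_rep H w))

/-- The stopped recursion as a function of the isomorphism class. -/
def classRatio (x : ℝ) (r : ℕ) (q : RootedClass) : ℝ :=
  truncRatio q.rep.2.1 x r Finset.univ q.rep.2.2

theorem classRatio_rootedClass [Fintype V] (G : SimpleGraph V) (v : V) (x : ℝ) (r : ℕ) :
    classRatio x r (rootedClass G v) = truncRatio G x r Finset.univ v :=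
  ((rootedIso_rep G v).truncRatio_eq x r).symm

/-- The class of the ball of radius `r` around `v`. -/
def ballClass [Fintype V] (G : SimpleGraph V) (r : ℕ) (v : V) : RootedClass :=
  rootedClass (ball G v r) (ballCenter G v r)

theorem classRatio_ballClass [Fintype V] (G : SimpleGraph V) (v : V) (x : ℝ) (r : ℕ) :
    classRatio x r (ballClass G r v) = truncRatio G x r Finset.univ v := by
  classical
  rw [← truncRatio_ball]
  exact ((rootedIso_rep (ball G v r) (ballCenter G v r)).truncRatio_eq x r).symm

/-- The class of the tree truncated after generation `r`. -/
def treeClass (r : ℕ) (k : List ℕ → ℕ) : RootedClass :=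
  rootedClass (truncTree k r) (treeRoot k r)

theorem classRatio_treeClass (r : ℕ) (k : List ℕ → ℕ) {x : ℝ} (hx : 0 < x) :
    classRatio x r (treeClass r k) = treeRatio k x r [] := by
  rw [treeClass, classRatio_rootedClass, truncRatio_truncTree k r hx]

theorem treeClass_congr {r : ℕ} {k k' : List ℕ → ℕ} (h : treeNodes k r = treeNodes k' r) :
    treeClass r k = treeClass r k' :=
  RootedIso.rootedClass_eq ⟨⟨Equiv.subtypeEquivRight fun u => by rw [h], Iff.rfl⟩, rfl⟩

theorem measurableSet_treeNodes_eq (r : ℕ) (N : Finset (List ℕ)) :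
    MeasurableSet {k : List ℕ → ℕ | treeNodes k r = N} := by
  have h : {k : List ℕ → ℕ | treeNodes k r = N} =
      ⋂ u : List ℕ, {k | u ∈ treeNodes k r ↔ u ∈ N} := by
    ext k; simp [Finset.ext_iff]
  rw [h]
  refine MeasurableSet.iInter fun u => ?_
  simp only [mem_treeNodes]
  exact (MeasurableSet.const _ |>.inter (measurableSet_mem_generation u _)).iff (.const _)

/-- The class depends only on the node set, which takes countably many values. -/
theorem measurable_treeClass (r : ℕ) : Measurable (treeClass r) := by
  refine measurable_to_countable' fun q => ?_
  have h : treeClass r ⁻¹' {q} = ⋃ N ∈ {N : Finset (List ℕ) | ∃ k, treeNodes k r = N ∧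
      treeClass r k = q}, {k | treeNodes k r = N} := by
    ext k
    simp only [mem_preimage, mem_singleton_iff, mem_ofPred_eq, mem_iUnion, exists_prop]
    constructor
    · exact fun hk => ⟨_, ⟨k, rfl, hk⟩, rfl⟩
    · rintro ⟨N, ⟨k', hk', rfl⟩, hk⟩
      exact treeClass_congr (hk.trans hk'.symm)
  rw [h]
  exact MeasurableSet.biUnion (to_countable _) fun N _ => measurableSet_treeNodes_eq r N

end Classes

/-! ### From frequencies to averages of bounded functions. -/

section Averages

/-- The average of `f` over the finite type `V`. -/
def average {V : Type*} [Fintype V] (f : V → ℝ) : ℝ := (∑ v, f v) / Fintype.card V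

theorem average_mono {V : Type*} [Fintype V] {f g : V → ℝ} (h : ∀ v, f v ≤ g v) :
    average f ≤ average g := by
  unfold average
  have := Finset.sum_le_sum fun v (_ : v ∈ Finset.univ) => h v
  gcongr

open Classical in
/-- Pointwise convergence of the frequencies of the values in a countable set to a probability
distribution implies convergence of the averages of bounded functions. -/
theorem eventually_le_average {Q : Type*} {V : ℕ → Type*} [∀ n, Fintype (V n)]
    (c : ∀ n, V n → Q) {π : Q → ℝ}
    (hconv : ∀ q, π q ≠ 0 → Tendsto (fun n => average fun v => if c n v = q then (1 : ℝ) else 0)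
      atTop (𝓝 (π q))) {g : Q → ℝ} (hg : ∀ q, 0 ≤ g q) {L : ℝ}
    (hL : HasSum (fun q => π q * g q) L) {a : ℝ} (ha : a < L) :
    ∀ᶠ n in atTop, a < average fun v => g (c n v) := by
  -- As in Fatou's lemma, a finite part of the sum already exceeds `a`; its null classes, whose
  -- frequencies are not controlled, contribute nothing.
  obtain ⟨F, hF⟩ := ((tendsto_order.1 hL).1 a ha).exists
  have h1 : Tendsto (fun n => ∑ q ∈ F.filter (π · ≠ 0),
      (average fun v => if c n v = q then (1 : ℝ) else 0) * g q) atTop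
      (𝓝 (∑ q ∈ F.filter (π · ≠ 0), π q * g q)) :=
    tendsto_finsetSum _ fun q hq => (hconv q (Finset.mem_filter.1 hq).2).mul_const _
  have h2 : ∑ q ∈ F.filter (π · ≠ 0), π q * g q = ∑ q ∈ F, π q * g q := by
    refine Finset.sum_filter_of_ne fun q _ h h' => h ?_
    rw [h', zero_mul]
  rw [h2] at h1
  filter_upwards [(tendsto_order.1 h1).1 a hF] with n hn
  refine hn.trans_le ?_
  unfold average
  simp_rw [div_mul_eq_mul_div, ← Finset.sum_div, Finset.sum_mul]
  rw [Finset.sum_comm]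
  refine div_le_div_of_nonneg_right (Finset.sum_le_sum fun v _ => ?_) (Nat.cast_nonneg _)
  simp only [ite_mul, one_mul, zero_mul, Finset.sum_ite_eq]
  split_ifs
  · exact le_rfl
  · exact hg _

-- The lower bound applied to `g` and to `1 - g` suffices: since `π` has total mass 1, no mass
-- escapes.
open Classical in
theorem tendsto_average {Q : Type*} {V : ℕ → Type*} [∀ n, Fintype (V n)]
    (c : ∀ n, V n → Q) {π : Q → ℝ} (hπ : HasSum π 1)
    (hconv : ∀ q, π q ≠ 0 → Tendsto (fun n => average fun v => if c n v = q then (1 : ℝ) else 0)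
      atTop (𝓝 (π q))) {g : Q → ℝ} (hg : ∀ q, g q ∈ Icc (0 : ℝ) 1) {L : ℝ}
    (hL : HasSum (fun q => π q * g q) L) :
    Tendsto (fun n => average fun v => g (c n v)) atTop (𝓝 L) := by
  refine tendsto_order.2 ⟨fun a ha => eventually_le_average c hconv (fun q => (hg q).1) hL ha,
    fun a ha => ?_⟩
  have hL' : HasSum (fun q => π q * (1 - g q)) (1 - L) := by
    simpa only [mul_sub, mul_one] using hπ.sub hL
  filter_upwards [eventually_le_average c hconv (fun q => sub_nonneg.2 (hg q).2) hL'
    (sub_lt_sub_left ha 1)] with n hn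
  have h : (average fun v => g (c n v)) + (average fun v => 1 - g (c n v)) ≤ 1 := by
    unfold average
    rw [← add_div, ← Finset.sum_add_distrib]
    simp only [add_sub_cancel, Finset.sum_const, Finset.card_univ, nsmul_eq_mul, mul_one]
    exact div_self_le_one _
  linarith

end Averages

/-! ### Convergence of the average monomer probability. -/

section LocalLimit

variable {Ω : Type*} [MeasurableSpace Ω] {μ : Measure Ω}
    {V : ℕ → Ω → Type*} [∀ n ω, Fintype (V n ω)] {G : ∀ n ω, SimpleGraph (V n ω)}
    {P ρ : PMF ℕ}

/-- The probability that the truncated Galton-Watson tree has a given class. -/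
def classProb (P ρ : PMF ℕ) (r : ℕ) (q : RootedClass) : ℝ :=
  (gwMeasure P ρ).real (treeClass r ⁻¹' {q})

theorem hasSum_classProb_mul (r : ℕ) {g : RootedClass → ℝ} (hg : ∀ q, g q ∈ Icc (0 : ℝ) 1) :
    HasSum (fun q => classProb P ρ r q * g q) (∫ k, g (treeClass r k) ∂(gwMeasure P ρ)) := by
  have := Measure.isProbabilityMeasure_map (μ := gwMeasure P ρ) (measurable_treeClass r).aemeasurable
  have hint : Integrable g ((gwMeasure P ρ).map (treeClass r)) :=
    Integrable.of_bound (measurable_of_countable g).aestronglyMeasurable 1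
      (Eventually.of_forall fun q => by
        rw [Real.norm_of_nonneg (hg q).1]; exact (hg q).2)
  have h := hasSum_integral_iUnion (f := g) (μ := (gwMeasure P ρ).map (treeClass r))
    (s := fun q : RootedClass => {q}) (fun q => measurableSet_singleton q)
    (fun p q h => disjoint_singleton.2 h) hint.integrableOn
  rw [iUnion_of_singleton, setIntegral_univ,
    integral_map (measurable_treeClass r).aemeasurable hint.aestronglyMeasurable] at h
  refine h.congr_fun fun q => ?_
  rw [integral_singleton, map_measureReal_apply (measurable_treeClass r)
    (measurableSet_singleton q)]
  rfl

theorem ae_tendsto_classFraction (hlocal : LocallyConverges μ G P ρ) :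
    ∀ᵐ ω ∂μ, ∀ r q, classProb P ρ r q ≠ 0 → Tendsto (fun n =>
      ballFraction (G n ω) r (RootedClass.rep q).2.1 (RootedClass.rep q).2.2) atTop
      (𝓝 (classProb P ρ r q)) := by
  refine ae_all_iff.2 fun r => ae_all_iff.2 fun q => ?_
  -- Local convergence is assumed only for trees; a class of positive probability is realised by
  -- some truncated tree.
  by_cases hq : classProb P ρ r q = 0
  · exact Eventually.of_forall fun ω h => absurd hq h
  obtain ⟨k, hk⟩ : (treeClass r ⁻¹' {q}).Nonempty := by
    by_contra h
    rw [not_nonempty_iff_eq_empty] at h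
    exact hq (by rw [classProb, h]; simp)
  obtain ⟨φ, hφ⟩ := rootedClass_eq_iff_rep.1 hk
  have hset : {k | RootedIso (truncTree k r) (treeRoot k r) q.rep.2.1 q.rep.2.2} =
      treeClass r ⁻¹' {q} := by
    ext k; exact rootedClass_eq_iff_rep.symm
  have h := hlocal r q.rep.1 q.rep.2.1 q.rep.2.2 (φ.isTree_iff.1 (isTree_truncTree k r)) fun v => by
    obtain ⟨u, rfl⟩ := φ.surjective v
    obtain ⟨p, hp⟩ := exists_walk_truncTree k r u.1 u.2
    rw [← hφ]
    refine (SimpleGraph.dist_le (p.map φ.toHom)).trans ?_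
    rw [SimpleGraph.Walk.length_map, hp]
    exact (mem_treeNodes.1 u.2).1
  filter_upwards [h] with ω hω _
  rwa [hset] at hω

open Classical in
theorem ballFraction_eq_average {V : Type*} [Fintype V] (G : SimpleGraph V) (r : ℕ)
    (q : RootedClass) : ballFraction G r q.rep.2.1 q.rep.2.2 =
      average fun v => if ballClass G r v = q then (1 : ℝ) else 0 := by
  rw [average, Finset.sum_boole, ballFraction]
  simp only [ballClass, rootedClass_eq_iff_rep]

theorem classRatio_mem {x : ℝ} (hx : 0 < x) (r : ℕ) (q : RootedClass) :
    classRatio x r q ∈ Icc (0 : ℝ) 1 := truncRatio_mem _ hx _ _ _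

/-- The exceptional null set comes from countably many pairs of radius and class, so it does not
depend on `x`. -/
theorem ae_tendsto_average_truncRatio (hlocal : LocallyConverges μ G P ρ) :
    ∀ᵐ ω ∂μ, ∀ (r : ℕ) (x : ℝ), 0 < x →
      Tendsto (fun n => average fun v => truncRatio (G n ω) x r Finset.univ v) atTop
        (𝓝 (∫ k, treeRatio k x r [] ∂(gwMeasure P ρ))) := by
  filter_upwards [ae_tendsto_classFraction hlocal] with ω hω r x hx
  have h := tendsto_average (fun n => ballClass (G n ω) r) (π := classProb P ρ r)
    (by simpa using hasSum_classProb_mul (P := P) (ρ := ρ) r (g := fun _ => 1) (by simp))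
    (fun q hq => (hω r q hq).congr fun n => ballFraction_eq_average (G n ω) r q)
    (classRatio_mem hx r) (hasSum_classProb_mul r (classRatio_mem hx r))
  simpa only [classRatio_ballClass, classRatio_treeClass r _ hx] using h

/-- Almost surely the root monomer probability of the truncated tree converges. -/
def HasRootLimit (P ρ : PMF ℕ) : Prop :=
  ∀ᵐ k ∂(gwMeasure P ρ), ∀ x : ℝ, 0 < x →
    Tendsto (fun r : ℕ => monomerProb (truncTree k r) x (treeRoot k r)) atTop
      (𝓝 (rootLimit k x))

theorem ae_tendsto_treeRatio (hlim : HasRootLimit P ρ) {x : ℝ} (hx : 0 < x) : ∀ᵐ k ∂(gwMeasure P ρ),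
    Tendsto (fun r : ℕ => treeRatio k x r []) atTop (𝓝 (rootLimit k x)) := by
  filter_upwards [hlim] with k hk
  exact (hk x hx).congr fun r => monomerProb_truncTree k r hx

theorem integrable_rootLimit (hlim : HasRootLimit P ρ) {x : ℝ} (hx : 0 < x) :
    Integrable (fun k => rootLimit k x) (gwMeasure P ρ) := by
  refine Integrable.of_bound (aestronglyMeasurable_of_tendsto_ae atTop
    (fun r => (measurable_treeRatio x r []).aestronglyMeasurable)
    (ae_tendsto_treeRatio hlim hx)) 1 ?_
  filter_upwards [ae_tendsto_treeRatio hlim hx] with k hk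
  refine le_of_tendsto hk.norm (Eventually.of_forall fun r => ?_)
  have h := treeRatio_mem k hx r []
  rw [Real.norm_of_nonneg h.1]; exact h.2

theorem tendsto_integral_treeRatio (hlim : HasRootLimit P ρ) {x : ℝ} (hx : 0 < x) :
    Tendsto (fun r => ∫ k, treeRatio k x r [] ∂(gwMeasure P ρ)) atTop
      (𝓝 (∫ k, rootLimit k x ∂(gwMeasure P ρ))) := by
  refine tendsto_integral_of_dominated_convergence (fun _ => 1)
    (fun r => (measurable_treeRatio x r []).aestronglyMeasurable) (integrable_const _)
    (fun r => Eventually.of_forall fun k => ?_) (ae_tendsto_treeRatio hlim hx)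
  have h := treeRatio_mem k hx r []
  rw [Real.norm_of_nonneg h.1]; exact h.2

/-- For fixed depth the odd and even stopped recursions squeeze the average as `n → ∞`; both tree
expectations then tend to `E[Y(x)]` as the depth grows. -/
theorem ae_tendsto_average_monomerProb (hlim : HasRootLimit P ρ)
    (hlocal : LocallyConverges μ G P ρ) :
    ∀ᵐ ω ∂μ, ∀ x : ℝ, 0 < x →
      Tendsto (fun n => average fun v => monomerProb (G n ω) x v) atTop
        (𝓝 (∫ k, rootLimit k x ∂(gwMeasure P ρ))) := by
  filter_upwards [ae_tendsto_average_truncRatio hlocal] with ω hω x hx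
  have hL := tendsto_integral_treeRatio hlim hx
  have hbet := fun n d v => subRatio_between (G n ω) hx d (Finset.mem_univ v)
  simp only [← monomerProb_eq_subRatio] at hbet
  refine tendsto_order.2 ⟨fun a ha => ?_, fun a ha => ?_⟩
  · obtain ⟨s, hs⟩ := ((tendsto_order.1 hL).1 a ha).exists_forall_of_atTop
    filter_upwards [(tendsto_order.1 (hω (2 * s + 1) x hx)).1 a (hs _ (by omega))] with n hn
    exact hn.trans_le (average_mono fun v => (hbet n (2 * s + 1) v).2 (odd_two_mul_add_one s))
  · obtain ⟨s, hs⟩ := ((tendsto_order.1 hL).2 a ha).exists_forall_of_atTop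
    filter_upwards [(tendsto_order.1 (hω (2 * s) x hx)).2 a (hs _ (by omega))] with n hn
    exact (average_mono fun v => (hbet n (2 * s) v).1 (even_two_mul s)).trans_lt hn

end LocalLimit

/-! ### The pressure of one graph: derivative and distance to `log x`. -/

section Pressure

theorem continuousOn_average_monomerProb {V : Type*} [Fintype V] (G : SimpleGraph V) :
    ContinuousOn (fun x => average fun v => monomerProb G x v) (Ioi 0) := by
  have h : ∀ S : Finset V, Continuous fun x : ℝ => subPartition G S x := fun S => by
    unfold subPartition; fun_prop
  unfold average
  refine ContinuousOn.div_const (continuousOn_finsetSum _ fun v _ => ?_) _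
  simp only [monomerProb_eq]
  exact (continuous_id.mul (h _)).continuousOn.div (h _).continuousOn
    fun x hx => (subPartition_pos _ _ hx).ne'

theorem average_monomerProb_mem {V : Type*} [Fintype V] (G : SimpleGraph V) {x : ℝ} (hx : 0 < x) :
    (average fun v => monomerProb G x v) ∈ Icc (0 : ℝ) 1 := by
  constructor
  · exact div_nonneg (Finset.sum_nonneg fun v _ => monomerProb_nonneg G hx v) (Nat.cast_nonneg _)
  · refine div_le_one_of_le₀ ((Finset.sum_le_card_nsmul _ _ 1 fun v _ => ?_).trans_eq ?_)
      (Nat.cast_nonneg _)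
    · refine (monomerProb_eq_subRatio G x v).trans_le ?_
      exact subRatio_le_one G hx (Finset.mem_univ v)
    · simp

theorem hasDerivAt_pressure {V : Type*} [Fintype V] (G : SimpleGraph V) {x : ℝ} (hx : 0 < x) :
    HasDerivAt (pressurePerParticle G) ((average fun v => monomerProb G x v) / x) x := by
  have hZ : 0 < partitionFunction G x := by
    rw [partitionFunction_eq]; exact subPartition_pos _ _ hx
  have h : HasDerivAt (pressurePerParticle G) _ x :=
    ((hasDerivAt_partitionFunction G hx).log hZ.ne').div_const (Fintype.card V : ℝ)
  refine h.congr_deriv ?_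
  unfold average
  field_simp

theorem uIcc_subset_Ioi {a x : ℝ} (ha : 0 < a) (hx : 0 < x) : uIcc a x ⊆ Ioi 0 := fun _ ht =>
  (lt_min ha hx).trans_le ht.1

theorem pressure_sub_eq_integral {V : Type*} [Fintype V] (G : SimpleGraph V) {a x : ℝ}
    (ha : 0 < a) (hx : 0 < x) :
    pressurePerParticle G x - pressurePerParticle G a =
      ∫ t in a..x, (average fun v => monomerProb G t v) / t := by
  have hsub := uIcc_subset_Ioi ha hx
  refine (intervalIntegral.integral_eq_sub_of_hasDerivAt
    (fun t ht => hasDerivAt_pressure G (hsub ht)) ?_).symm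
  exact (((continuousOn_average_monomerProb G).div continuousOn_id
    fun t ht => (ne_of_gt ht)).mono hsub).intervalIntegrable

open Classical in
theorem abs_pressure_sub_log_le {V : Type*} [Fintype V] (G : SimpleGraph V) {C x : ℝ}
    (hx : 0 < x) (hV : 0 < Fintype.card V) (hC : (G.edgeFinset.card : ℝ) ≤ C * Fintype.card V) :
    |pressurePerParticle G x - Real.log x| ≤ C * (x ^ 2)⁻¹ := by
  have hV' : (0 : ℝ) < Fintype.card V := by exact_mod_cast hV
  have hlow := Real.log_le_log (by positivity) (partitionFunction_ge G hx)
  have hupp := Real.log_le_log ((pow_pos hx _).trans_le (partitionFunction_ge G hx))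
    (partitionFunction_le G hx)
  rw [Real.log_mul (by positivity) (by positivity), Real.log_pow, Real.log_pow] at hupp
  rw [Real.log_pow] at hlow
  have hlog : Real.log (1 + (x ^ 2)⁻¹) ≤ (x ^ 2)⁻¹ := by
    have := Real.log_le_sub_one_of_pos (show 0 < 1 + (x ^ 2)⁻¹ by positivity)
    linarith
  have h3 : (G.edgeFinset.card : ℝ) * Real.log (1 + (x ^ 2)⁻¹) ≤
      C * Fintype.card V * (x ^ 2)⁻¹ :=
    (mul_le_mul_of_nonneg_left hlog (Nat.cast_nonneg _)).trans
      (mul_le_mul_of_nonneg_right hC (by positivity))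
  rw [pressurePerParticle, abs_of_nonneg]
  · rw [sub_le_iff_le_add, div_le_iff₀ hV']
    linarith
  · rw [sub_nonneg, le_div_iff₀ hV']
    linarith

end Pressure

/-! ### Limits of pressures along one sequence of graphs. -/

section Limits

variable {V : ℕ → Type*} [∀ n, Fintype (V n)] {G : ∀ n, SimpleGraph (V n)} {M : ℝ → ℝ}

theorem exists_holomorphic_extension
    (hM : ∀ x, 0 < x → Tendsto (fun n => average fun v => monomerProb (G n) x v) atTop (𝓝 (M x)))
    {x : ℝ} (hx : 0 < x) : ∃ g : ℂ → ℂ, DifferentiableOn ℂ g (Metric.ball (x : ℂ) (x / 2)) ∧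
      ∀ t : ℝ, |t - x| < x / 2 → g t = M t := by
  have hreal : ∀ t : ℝ, 0 < t → Tendsto (fun n =>
      (∑ v, complexMonomerProb (G n) v (t : ℂ)) / (Fintype.card (V n) : ℂ)) atTop
      (𝓝 (M t : ℂ)) := fun t ht => by
    refine ((Complex.continuous_ofReal.tendsto _).comp (hM t ht)).congr fun n => ?_
    simp [average, complexMonomerProb_ofReal]
  obtain ⟨g, hg, hlim⟩ := exists_holomorphic_limit_halfPlane (X := 0)
    (f := fun n z => (∑ v, complexMonomerProb (G n) v z) / (Fintype.card (V n) : ℂ))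
    (fun n => (DifferentiableOn.fun_sum fun v _ =>
      differentiableOn_complexMonomerProb (G n) v).div_const _)
    (fun n z hz => by
      rw [norm_div, Complex.norm_natCast]
      refine div_le_of_le_mul₀ (Nat.cast_nonneg _) (by positivity) ?_
      refine (norm_sum_le_of_le _ fun v _ => norm_complexMonomerProb_le (G n) v hz).trans_eq ?_
      simp [mul_comm])
    (fun t ht => ⟨_, hreal t ht⟩) hx
  refine ⟨g, hg, fun t ht => tendsto_nhds_unique (hlim t ?_) (hreal t ?_)⟩
  · rwa [Metric.mem_ball, dist_eq_norm, ← Complex.ofReal_sub, Complex.norm_real]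
  · linarith [(abs_lt.1 ht).1]

theorem continuousOn_limit
    (hM : ∀ x, 0 < x → Tendsto (fun n => average fun v => monomerProb (G n) x v) atTop (𝓝 (M x))) :
    ContinuousOn M (Ioi 0) := by
  intro x hx
  rw [mem_Ioi] at hx
  obtain ⟨g, hg, hgM⟩ := exists_holomorphic_extension hM hx
  have h1 : ContinuousAt g x :=
    (hg.differentiableAt (Metric.ball_mem_nhds _ (by positivity))).continuousAt
  have h2 : ContinuousAt (fun t : ℝ => (g t).re) x :=
    Complex.continuous_re.continuousAt.comp
      (h1.comp (f := fun t : ℝ => (t : ℂ)) Complex.continuous_ofReal.continuousAt)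
  refine (h2.congr ?_).continuousWithinAt
  filter_upwards [Metric.ball_mem_nhds x (half_pos hx)] with t ht
  rw [hgM t ht, Complex.ofReal_re]

theorem intervalIntegrable_limit_div
    (hM : ∀ x, 0 < x → Tendsto (fun n => average fun v => monomerProb (G n) x v) atTop (𝓝 (M x)))
    {a x : ℝ} (ha : 0 < a) (hx : 0 < x) :
    IntervalIntegrable (fun t => M t / t) volume a x :=
  (((continuousOn_limit hM).div continuousOn_id fun _ ht => ne_of_gt ht).mono
    (uIcc_subset_Ioi ha hx)).intervalIntegrable

theorem tendsto_pressure_sub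
    (hM : ∀ x, 0 < x → Tendsto (fun n => average fun v => monomerProb (G n) x v) atTop (𝓝 (M x)))
    {a x : ℝ} (ha : 0 < a) (hx : 0 < x) :
    Tendsto (fun n => pressurePerParticle (G n) x - pressurePerParticle (G n) a) atTop
      (𝓝 (∫ t in a..x, M t / t)) := by
  simp only [pressure_sub_eq_integral _ ha hx]
  have hsub : uIoc a x ⊆ Ioi 0 := uIoc_subset_uIcc.trans (uIcc_subset_Ioi ha hx)
  refine intervalIntegral.tendsto_integral_filter_of_dominated_convergence (fun t => t⁻¹)
    (Eventually.of_forall fun n => ?_) (Eventually.of_forall fun n => Eventually.of_forall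
      fun t ht => ?_) ?_ (Eventually.of_forall fun t ht => (hM t (hsub ht)).div_const t)
  · exact (((continuousOn_average_monomerProb (G n)).div continuousOn_id
      fun t ht => ne_of_gt ht).mono hsub).aestronglyMeasurable measurableSet_uIoc
  · have ht0 : 0 < t := hsub ht
    have h := average_monomerProb_mem (G n) ht0
    rw [norm_div, Real.norm_of_nonneg h.1, Real.norm_of_nonneg ht0.le, ← one_div]
    exact div_le_div_of_nonneg_right h.2 ht0.le
  · exact ((continuousOn_inv₀.mono fun t ht => ne_of_gt ht).mono
      (uIcc_subset_Ioi ha hx)).intervalIntegrable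

/-- At large `X` the pressure is nearly `log X`, and the increment from `a` to `X` converges; this
gives convergence at `a`. The limit is written in terms of `M` alone, hence is the same for all
realisations sharing `M`. -/
theorem tendsto_pressure
    (hM : ∀ x, 0 < x → Tendsto (fun n => average fun v => monomerProb (G n) x v) atTop (𝓝 (M x)))
    {C : ℝ} (hC : ∀ x : ℝ, 0 < x →
      ∀ᶠ n in atTop, |pressurePerParticle (G n) x - Real.log x| ≤ C * (x ^ 2)⁻¹)
    {a : ℝ} (ha : 0 < a) :
    Tendsto (fun n => pressurePerParticle (G n) a) atTop
      (𝓝 (limUnder atTop fun X => Real.log X - ∫ t in a..X, M t / t)) := by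
  have hq : ∀ X, 0 < X → Tendsto (fun n => Real.log X -
      (pressurePerParticle (G n) X - pressurePerParticle (G n) a)) atTop
      (𝓝 (Real.log X - ∫ t in a..X, M t / t)) := fun X hX =>
    (tendsto_pressure_sub hM ha hX).const_sub _
  have hbound : ∀ X : ℝ, 0 < X → ∀ᶠ n in atTop, ‖Real.log X -
      (pressurePerParticle (G n) X - pressurePerParticle (G n) a) - pressurePerParticle (G n) a‖
      ≤ C * (X ^ 2)⁻¹ := fun X hX => by
    filter_upwards [hC X hX] with n hn
    rw [Real.norm_eq_abs, ← abs_neg]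
    convert hn using 2
    ring
  obtain ⟨l, hl⟩ := exists_tendsto_of_approx one_pos
    (u := fun n => pressurePerParticle (G n) a) (C := C) fun t ht _ => by
      -- With `X = 1 / √t` the error `C / X ^ 2` becomes `C * t`.
      have hX : 0 < (√t)⁻¹ := by positivity
      refine ⟨_, ⟨_, hq _ hX⟩, ?_⟩
      have h := hbound _ hX
      rwa [inv_pow, inv_inv, Real.sq_sqrt ht.le] at h
  have hl' : Tendsto (fun X => Real.log X - ∫ t in a..X, M t / t) atTop (𝓝 l) := by
    rw [tendsto_iff_norm_sub_tendsto_zero]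
    have h0 : Tendsto (fun X : ℝ => C * (X ^ 2)⁻¹) atTop (𝓝 0) := by
      simpa using (tendsto_inv_atTop_zero.comp (tendsto_pow_atTop two_ne_zero)).const_mul C
    refine squeeze_zero' (Eventually.of_forall fun _ => norm_nonneg _) ?_ h0
    filter_upwards [eventually_gt_atTop 0] with X hX
    exact le_of_tendsto ((hq X hX).sub hl).norm (hbound X hX)
  rwa [hl'.limUnder_eq]

/-- Near `c` the integrand is the restriction of a holomorphic function on a disc avoiding 0. This
has a primitive there, whose real part differs from the integral by a constant. -/
theorem analyticOnNhd_integral_limit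
    (hM : ∀ x, 0 < x → Tendsto (fun n => average fun v => monomerProb (G n) x v) atTop (𝓝 (M x)))
    (b : ℝ) {a : ℝ} (ha : 0 < a) :
    AnalyticOnNhd ℝ (fun x => b + ∫ t in a..x, M t / t) (Ioi 0) := by
  intro c hc
  rw [mem_Ioi] at hc
  obtain ⟨g, hg, hgM⟩ := exists_holomorphic_extension hM hc
  have hz : ∀ z ∈ Metric.ball (c : ℂ) (c / 2), z ≠ 0 := by
    rintro z hz rfl
    rw [Metric.mem_ball, dist_eq_norm, zero_sub, norm_neg, Complex.norm_real,
      Real.norm_of_nonneg hc.le] at hz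
    linarith
  obtain ⟨Φ, hΦ⟩ := (hg.div differentiableOn_id hz).isExactOn_ball
  have hreal : ∀ t : ℝ, |t - c| < c / 2 → HasDerivAt (fun s : ℝ => (Φ s).re) (M t / t) t := by
    intro t ht
    have h := (hΦ t (by rwa [Metric.mem_ball, dist_eq_norm, ← Complex.ofReal_sub,
      Complex.norm_real])).real_of_complex
    convert h using 1
    rw [Pi.div_apply, hgM t ht, id_eq, ← Complex.ofReal_div, Complex.ofReal_re]
  have hana : AnalyticAt ℂ Φ c := DifferentiableOn.analyticAt
    (fun z hz => (hΦ z hz).differentiableAt.differentiableWithinAt)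
    (Metric.ball_mem_nhds _ (half_pos hc))
  have hre : AnalyticAt ℝ (fun t : ℝ => (Φ t).re) c := hana.re_ofReal
  have hconst : AnalyticAt ℝ (fun _ : ℝ => b + (∫ t in a..c, M t / t) - (Φ c).re) c :=
    analyticAt_const
  refine (hconst.add hre).congr ?_
  filter_upwards [Metric.ball_mem_nhds c (half_pos hc)] with x hx
  rw [Metric.mem_ball, Real.dist_eq] at hx
  have hx0 : 0 < x := by linarith [(abs_lt.1 hx).1]
  have h1 : ∫ t in c..x, M t / t = (Φ x).re - (Φ c).re := by
    refine intervalIntegral.integral_eq_sub_of_hasDerivAt (fun t ht => hreal t ?_)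
      (intervalIntegrable_limit_div hM hc hx0)
    exact (abs_sub_left_of_mem_uIcc ht).trans_lt hx
  rw [← intervalIntegral.integral_add_adjacent_intervals
    (intervalIntegrable_limit_div hM ha hc) (intervalIntegrable_limit_div hM hc hx0), h1]
  simp only [Pi.add_apply]
  ring

end Limits

/-! ### Linear bounds on the number of edges. -/

section Sparsity

variable {Ω : Type*} [MeasurableSpace Ω] {μ : Measure Ω}
    {V : ℕ → Ω → Type*} [∀ n ω, Fintype (V n ω)] {G : ∀ n ω, SimpleGraph (V n ω)}
    {P ρ : PMF ℕ}

open Classical in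
theorem card_edgeFinset_le {V : Type*} [Fintype V] (G : SimpleGraph V) (l : ℕ)
    (h : (∑ v : V, if l ≤ G.degree v then (G.degree v : ℝ≥0∞) else 0) /
      (Fintype.card V : ℝ≥0∞) < 1) :
    (G.edgeFinset.card : ℝ) ≤ (l + 1 : ℝ) * Fintype.card V := by
  have h1 : (∑ v : V, if l ≤ G.degree v then G.degree v else 0) ≤ Fintype.card V := by
    rcases Nat.eq_zero_or_pos (Fintype.card V) with h0 | h0
    · have := Fintype.card_eq_zero_iff.1 h0
      simp
    · rw [ENNReal.div_lt_iff (Or.inl (by exact_mod_cast h0.ne')) (Or.inl (ENNReal.natCast_ne_top _)),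
        one_mul] at h
      have h' : ((∑ v : V, if l ≤ G.degree v then G.degree v else 0 : ℕ) : ℝ≥0∞) <
          (Fintype.card V : ℝ≥0∞) := by
        push_cast
        exact h
      exact_mod_cast h'.le
  have h2 : ∑ v : V, G.degree v ≤
      ∑ v : V, (l + if l ≤ G.degree v then G.degree v else 0) :=
    Finset.sum_le_sum fun v _ => by split_ifs <;> omega
  rw [Finset.sum_add_distrib, Finset.sum_const, Finset.card_univ, smul_eq_mul,
    G.sum_degrees_eq_twice_card_edges] at h2
  have h3 : G.edgeFinset.card ≤ (l + 1) * Fintype.card V := by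
    rw [add_mul, one_mul]
    linarith
  exact_mod_cast h3

open Classical in
theorem ae_exists_card_edgeFinset_le (hsparse : UniformlySparse μ G) :
    ∀ᵐ ω ∂μ, ∃ C : ℝ, ∀ᶠ n in atTop,
      ((G n ω).edgeFinset.card : ℝ) ≤ C * Fintype.card (V n ω) := by
  filter_upwards [hsparse] with ω hω
  obtain ⟨l, hl⟩ := ((tendsto_order.1 hω).2 1 one_pos).exists
  refine ⟨l + 1, ?_⟩
  filter_upwards [eventually_lt_of_limsup_lt hl] with n hn
  exact card_edgeFinset_le (G n ω) l hn

/-- At depth 0 the averaged function is the constant 1, whose average is 0 on an empty vertex set;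
its limit is 1. -/
theorem ae_eventually_card_pos (hlocal : LocallyConverges μ G P ρ) :
    ∀ᵐ ω ∂μ, ∀ᶠ n in atTop, 0 < Fintype.card (V n ω) := by
  filter_upwards [ae_tendsto_average_truncRatio hlocal] with ω hω
  have h := hω 0 1 one_pos
  simp only [truncRatio, treeRatio, integral_const, probReal_univ, smul_eq_mul, mul_one] at h
  filter_upwards [(tendsto_order.1 h).1 0 one_pos] with n hn
  by_contra h0
  rw [average, Nat.eq_zero_of_not_pos h0] at hn
  simp at hn

theorem ae_exists_abs_pressure_sub_log_le (hlocal : LocallyConverges μ G P ρ)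
    (hsparse : UniformlySparse μ G) :
    ∀ᵐ ω ∂μ, ∃ C : ℝ, ∀ x : ℝ, 0 < x → ∀ᶠ n in atTop,
      |pressurePerParticle (G n ω) x - Real.log x| ≤ C * (x ^ 2)⁻¹ := by
  filter_upwards [ae_exists_card_edgeFinset_le hsparse, ae_eventually_card_pos hlocal]
    with ω ⟨C, hC⟩ hpos
  refine ⟨C, fun x hx => ?_⟩
  filter_upwards [hC, hpos] with n hn hn'
  exact abs_pressure_sub_log_le (G n ω) hx hn' hn

end Sparsity

end MonomerDimer

end

theorem mainTheorem4 {Ω : Type*} [MeasurableSpace Ω] (μ : Measure Ω) [IsProbabilityMeasure μ]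
    {V : ℕ → Ω → Type*} [∀ n ω, Fintype (V n ω)] (G : ∀ n ω, SimpleGraph (V n ω))
    (P ρ : PMF ℕ) (hunimodular : MonomerDimer.IsUnimodular P ρ)
    (hlocal : MonomerDimer.LocallyConverges μ G P ρ)
    (hmoment : ∑' k : ℕ, (k : ℝ≥0∞) ^ 2 * P k < ∞)
    (hsparse : MonomerDimer.UniformlySparse μ G) :
    -- the random variable `Y(x)` is well defined and has an expectation
    (∀ᵐ k ∂(MonomerDimer.gwMeasure P ρ), ∀ x : ℝ, 0 < x →
      Tendsto (fun r : ℕ => MonomerDimer.monomerProb (MonomerDimer.truncTree k r) x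
        (MonomerDimer.treeRoot k r)) atTop (𝓝 (MonomerDimer.rootLimit k x))) ∧
    (∀ x : ℝ, 0 < x →
      Integrable (fun k => MonomerDimer.rootLimit k x) (MonomerDimer.gwMeasure P ρ)) ∧
    (∀ a x : ℝ, 0 < a → 0 < x → IntervalIntegrable
      (fun t => (∫ k, MonomerDimer.rootLimit k t ∂(MonomerDimer.gwMeasure P ρ)) / t)
      volume a x) ∧
    -- the pressure per particle converges
    ∃ p : ℝ → ℝ,
      (∀ᵐ ω ∂μ, ∀ a : ℝ, 0 < a →
        Tendsto (fun n => MonomerDimer.pressurePerParticle (G n ω) a) atTop (𝓝 (p a))) ∧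
      (∀ᵐ ω ∂μ, ∀ a : ℝ, 0 < a → ∀ x : ℝ, 0 < x →
        Tendsto (fun n => MonomerDimer.pressurePerParticle (G n ω) x) atTop
          (𝓝 (p a + ∫ t in a..x,
            (∫ k, MonomerDimer.rootLimit k t ∂(MonomerDimer.gwMeasure P ρ)) / t))) ∧
      ∀ a : ℝ, 0 < a → AnalyticOnNhd ℝ
        (fun x => p a + ∫ t in a..x,
          (∫ k, MonomerDimer.rootLimit k t ∂(MonomerDimer.gwMeasure P ρ)) / t) (Ioi 0) := by
  have hlim : MonomerDimer.HasRootLimit P ρ :=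
    MonomerDimer.ae_tendsto_rootLimit hunimodular hmoment
  have hM := MonomerDimer.ae_tendsto_average_monomerProb hlim hlocal
  have hlog := MonomerDimer.ae_exists_abs_pressure_sub_log_le hlocal hsparse
  -- The limit `E[Y]` is deterministic, so one good realisation suffices to read off its regularity.
  obtain ⟨ω₀, hω₀⟩ := hM.exists
  refine ⟨hlim, fun x hx => MonomerDimer.integrable_rootLimit hlim hx,
    fun a x ha hx => MonomerDimer.intervalIntegrable_limit_div hω₀ ha hx,
    fun a => limUnder atTop fun X => Real.log X - ∫ t in a..X,
      (∫ k, MonomerDimer.rootLimit k t ∂(MonomerDimer.gwMeasure P ρ)) / t, ?_, ?_,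
    fun a ha => MonomerDimer.analyticOnNhd_integral_limit hω₀ _ ha⟩
  · filter_upwards [hM, hlog] with ω hω ⟨C, hC⟩ a ha
    exact MonomerDimer.tendsto_pressure hω hC ha
  · filter_upwards [hM, hlog] with ω hω ⟨C, hC⟩ a ha x hx
    refine ((MonomerDimer.tendsto_pressure hω hC ha).add
      (MonomerDimer.tendsto_pressure_sub hω ha hx)).congr fun n => ?_
    ring
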